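/- For $t_z\in(0,2)$ and $\mathbf k\in[-\pi,\pi]^3$ let $\varepsilon(\mathbf k)=-2(\cos k_1+\cos k_2)-2t_z\cos k_3$, and let $$N_{t_z}(\epsilon)=\int_{[-\pi,\pi]^3}\delta(\varepsilon(\mathbf k)-\epsilon)\,\frac{d\mathbf k}{(2\pi)^3}=\frac{d}{d\epsilon}\,\frac{\big|\{\mathbf k\in[-\pi,\pi]^3:\varepsilon(\mathbf k)\le\epsilon\}\big|}{(2\pi)^3}$$ be the density of states. For $U>0$ let the Néel temperature $T_N(U,t_z)$ be the unique solution $T>0$ of $$1=\int_{[-\pi,\pi]^3}\frac{U\tanh\big(\frac{\varepsilon(\mathbf k)}{2T}\big)}{2\varepsilon(\mathbf k)}\,\frac{d\mathbf k}{(2\pi)^3},$$ and let $$b_0(t_z)=\int_0^{4+2t_z}\big(N_{t_z}(\epsilon)-N_{t_z}(0)\big)\frac{1}{\epsilon}\,d\epsilon .$$ For every $t_z\in(0,2)$ these quantities are well defined: $N_{t_z}$ is the Lebesgue density of the distribution of $\varepsilon(\mathbf k)$ under $d\mathbf k/(2\pi)^3$ on $[-\pi,\pi]^3$, it is continuous at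 $0$ with $N_{t_z}(0)>0$, the integrand of $b_0(t_z)$ is integrable, and for each $U>0$ the equation for $T_N(U,t_z)$ has exactly one positive solution. Moreover $$T_N(U,t_z)=\frac{8+4t_z}{\pi e^{-\gamma}}\,e^{-\frac{1}{N_{t_z}(0)}\left(\frac1U-b_0(t_z)\right)}\Big(1+O\big(e^{-\frac{2}{N_{t_z}(0)U}}\big)\Big)\qquad\text{as } U\downarrow0,$$ uniformly for $t_z$ in compact subsets of $(0,2)$, where $\gamma$ is Euler's constant; that is, for each compact $K\subset(0,2)$ the constant in the $O$-term and the range $0<U<U_0$ of validity depend only on $K$. -/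

import Mathlib

open Real MeasureTheory Set

noncomputable section

namespace Hubbard

/-- The cube `[-π, π]³` of quasi-momenta. -/
def momentumCube : Set (Fin 3 → ℝ) := Set.Icc (fun _ => -π) (fun _ => π)

/-- The tight-binding band relation `ε(k) = -2 (cos k₁ + cos k₂) - 2 t_z cos k₃`
(the hopping in the two planar directions is normalized to `1`). -/
def band (tz : ℝ) (k : Fin 3 → ℝ) : ℝ :=
  -2 * (cos (k 0) + cos (k 1)) - 2 * tz * cos (k 2)

/-- The normalized measure `dk₁ dk₂ dk₃ / (2π)³` on the cube `[-π, π]³`. -/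
def momentumMeasure : Measure (Fin 3 → ℝ) :=
  ENNReal.ofReal (((2 * π) ^ 3)⁻¹) • volume.restrict momentumCube

/-- The integrated density of states: the normalized volume of `{k ∈ [-π, π]³ | ε(k) ≤ e}`,
that is `∫ θ(e - ε(k)) dk / (2π)³` with `θ` the Heaviside function. -/
def integratedDensity (tz e : ℝ) : ℝ :=
  momentumMeasure.real {k | band tz k ≤ e}

/-- The density of states `N_{t_z}(e) = ∫ δ(ε(k) - e) dk / (2π)³`, as a function of `e`: the
pointwise derivative of the integrated density of states. -/
def densityOfStates (tz e : ℝ) : ℝ :=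
  deriv (integratedDensity tz) e

/-- `T > 0` solves the equation `1 = ∫ U tanh (ε(k) / (2T)) / (2 ε(k)) dk / (2π)³` over
`[-π, π]³`. (The zero set of `ε`, where Lean evaluates the quotient as `0`, is a null set.) -/
def IsNeelTemperature (U tz T : ℝ) : Prop :=
  0 < T ∧
    1 = ∫ k in momentumCube,
      U * tanh (band tz k / (2 * T)) / (2 * band tz k) * ((2 * π) ^ 3)⁻¹

/-- The Néel temperature `T_N(U, t_z)`: the positive solution of the equation above. -/
def neelTemperature (U tz : ℝ) : ℝ :=
  Classical.epsilon (IsNeelTemperature U tz)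

/-- `b₀(t_z) = ∫_0^{4 + 2 t_z} (N_{t_z}(e) - N_{t_z}(0)) / e de`. -/
def bZero (tz : ℝ) : ℝ :=
  ∫ e in (0 : ℝ)..(4 + 2 * tz), (densityOfStates tz e - densityOfStates tz 0) * (1 / e)

end Hubbard

end

noncomputable section

namespace Hubbard

open Filter Topology

open scoped ENNReal

/-! The band energy is distributed as `x + y + tz * z` with `x, y, z` independent copies of `-2 cos
k`. Its density `N` is even, so with `a = 4 + 2 tz` the equation for `T` becomes `1/U = ∫₀^a N(e)
tanh(e/2T)/e de` (`gapIntegral_eq`). Writing `N = N(0) + (N - N(0))` gives `1/U = N(0) (log(a/2T) +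
log(4/π) + γ) + b₀ + O(T²)`, which is `abs_gapIntegral_sub_le`. Solved for `log T`, this says that
`T` is the leading expression times `exp r` with `r = O(T²)`. The a priori bound `T ≤ U/4` makes
`|r| ≤ 1`, hence `T` is at most three times the leading expression, whose square is
`O(exp(-2/(N(0)U)))`; so `r` is of that order too.

Two facts carry the expansion. One is `∫₀^X tanh x / x dx = log X + log(4/π) + γ + O(X⁻²)`, where
`γ` comes from `Γ'(1)` and `π` from Wallis' product. The other is `|N(e) - N(0)| ≤ B e²` near `0`,
uniformly on compact sets of `tz`. It holds because the critical energies `±2 ± 2 ± 2tz` stay away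
from `0`: at small energy one of the three variables is away from `±2`, where its density is smooth.
Integrating that variable out bounds the second differences of `N` at `0`, and evenness turns this
into the quadratic bound.

Existence of `T` follows from the intermediate value theorem, uniqueness from strict monotonicity of
the gap integral. -/

/-! ### Elementary bounds for `tanh`. -/

theorem tanh_eq_one_sub (x : ℝ) : tanh x = 1 - 2 / (exp (2 * x) + 1) := by
  rw [Real.tanh_eq, Real.exp_neg, two_mul, Real.exp_add]
  have := Real.exp_pos x
  field_simp
  ring

theorem strictMono_tanh : StrictMono Real.tanh := by
  intro x y h
  rw [tanh_eq_one_sub, tanh_eq_one_sub]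
  have : exp (2 * x) < exp (2 * y) := Real.exp_lt_exp.2 (by linarith)
  gcongr

theorem continuous_tanh : Continuous Real.tanh := by
  have : Real.tanh = fun x => 1 - 2 / (exp (2 * x) + 1) := funext tanh_eq_one_sub
  rw [this]
  refine continuous_const.sub (continuous_const.div (by fun_prop) fun x => ?_)
  positivity

theorem tanh_nonneg {x : ℝ} (hx : 0 ≤ x) : 0 ≤ tanh x := by
  simpa using strictMono_tanh.monotone hx

theorem tanh_le_self {x : ℝ} (hx : 0 ≤ x) : tanh x ≤ x := by
  rw [Real.tanh_eq_sinh_div_cosh, div_le_iff₀ (Real.cosh_pos x)]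
  have hd : ∀ y, HasDerivAt (fun y => y * cosh y - sinh y) (y * sinh y) y := fun y => by
    have := ((hasDerivAt_id y).mul (Real.hasDerivAt_cosh y)).sub (Real.hasDerivAt_sinh y)
    exact this.congr_deriv (by simp)
  have hm : MonotoneOn (fun y => y * cosh y - sinh y) (Ici 0) := by
    apply monotoneOn_of_deriv_nonneg (convex_Ici 0)
    · exact fun y _ => (hd y).continuousAt.continuousWithinAt
    · exact fun y _ => (hd y).differentiableAt.differentiableWithinAt
    · intro y hy
      rw [interior_Ici] at hy
      rw [(hd y).deriv]
      exact mul_nonneg hy.le (Real.sinh_nonneg_iff.2 hy.le)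
  have := hm self_mem_Ici (mem_Ici.2 hx) hx
  simp at this
  linarith

theorem one_sub_tanh_le_exp (x : ℝ) : 1 - tanh x ≤ 2 * exp (-(2 * x)) := by
  rw [tanh_eq_one_sub, Real.exp_neg, sub_sub_cancel, ← div_eq_mul_inv]
  have := Real.exp_pos (2 * x)
  gcongr
  linarith

/-- Quadratic decay is all that an error of order `T²` requires away from energy `0`. -/
theorem one_sub_tanh_le_inv_sq {x : ℝ} (hx : 0 < x) : 1 - tanh x ≤ 1 / x ^ 2 := by
  refine (one_sub_tanh_le_exp x).trans ?_
  have := Real.quadratic_le_exp_of_nonneg (x := 2 * x) (by positivity)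
  rw [Real.exp_neg, ← div_eq_mul_inv, div_le_div_iff₀ (by positivity) (by positivity)]
  nlinarith

theorem one_sub_tanh_nonneg (x : ℝ) : 0 ≤ 1 - tanh x := by
  linarith [Real.tanh_lt_one x]

theorem tanh_div_nonneg (x : ℝ) : 0 ≤ tanh x / x := by
  rcases le_total 0 x with h | h
  · exact div_nonneg (tanh_nonneg h) h
  · have := tanh_nonneg (x := -x) (by linarith)
    rw [Real.tanh_neg] at this
    exact div_nonneg_of_nonpos (by linarith) h

theorem tanh_div_le_one (x : ℝ) : tanh x / x ≤ 1 := by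
  have key : ∀ y : ℝ, 0 ≤ y → tanh y / y ≤ 1 := fun y hy => div_le_one_of_le₀ (tanh_le_self hy) hy
  rcases le_total 0 x with h | h
  · exact key x h
  · have := key (-x) (by linarith)
    rwa [Real.tanh_neg, neg_div_neg_eq] at this

theorem measurable_tanh_div : Measurable fun x : ℝ => tanh x / x :=
  continuous_tanh.measurable.div measurable_id

theorem intervalIntegrable_tanh_div (a b : ℝ) :
    IntervalIntegrable (fun x => tanh x / x) volume a b := by
  refine (intervalIntegrable_const (c := (1 : ℝ))).mono_fun
    measurable_tanh_div.aestronglyMeasurable (ae_of_all _ fun x => ?_)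
  simp only
  rw [Real.norm_of_nonneg (tanh_div_nonneg x), norm_one]
  exact tanh_div_le_one x

/-! ### The constant `log (π / 2)`: Frullani integrals and Wallis' product. -/

theorem integrableOn_exp_sub_exp_div {a b : ℝ} (ha : 0 < a) (hab : a ≤ b) :
    IntegrableOn (fun x => x⁻¹ * (exp (-(a * x)) - exp (-(b * x)))) (Ioi 0) := by
  have hi : IntegrableOn (fun x => (b - a) * exp (-a * x)) (Ioi 0) :=
    (integrableOn_exp_mul_Ioi (by linarith) 0).const_mul _
  refine hi.mono' (by fun_prop) ((ae_restrict_mem measurableSet_Ioi).mono fun x hx => ?_)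
  rw [mem_Ioi] at hx
  have h1 : exp (-(b * x)) = exp (-(a * x)) * exp (-((b - a) * x)) := by
    rw [← Real.exp_add]; ring_nf
  have h2 : exp (-((b - a) * x)) ≤ 1 := Real.exp_le_one_iff.2 (by nlinarith)
  have h3 := Real.one_sub_le_exp_neg ((b - a) * x)
  have h4 : x⁻¹ * (exp (-(a * x)) - exp (-(b * x)))
      = exp (-(a * x)) * ((1 - exp (-((b - a) * x))) / x) := by rw [h1]; ring
  rw [h4, Real.norm_of_nonneg (mul_nonneg (Real.exp_pos _).le (div_nonneg (by linarith) hx.le)),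
    mul_comm (b - a) (exp _), neg_mul]
  refine mul_le_mul_of_nonneg_left ?_ (Real.exp_pos _).le
  rw [div_le_iff₀ hx]
  linarith

theorem integral_exp_sub_exp_div {a b : ℝ} (ha : 0 < a) (hab : a ≤ b) :
    ∫ x in Ioi 0, x⁻¹ * (exp (-(a * x)) - exp (-(b * x))) = log (b / a) := by
  have hc : Continuous fun x : ℝ => exp (-x) := by fun_prop
  have := Frullani.integral_Ioi_eq (f := fun x => exp (-x)) (L := 1) (R := 0) (a := a) (b := b)
    (hc.locallyIntegrable.locallyIntegrableOn _) ha (ha.trans_le hab)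
    (by simpa using (hc.tendsto 0).mono_left nhdsWithin_le_nhds)
    (by simpa using Real.tendsto_exp_neg_atTop_nhds_zero)
    (by simpa using integrableOn_exp_sub_exp_div ha hab)
  simpa using this

theorem tendsto_log_wallis : Tendsto (fun n => log (Real.Wallis.W n)) atTop (𝓝 (log (π / 2))) :=
  (Real.continuousAt_log (by positivity)).tendsto.comp Real.Wallis.tendsto_W_nhds_pi_div_two

theorem exp_mul_tanh (x : ℝ) :
    exp (-(2 * x)) * tanh x = exp (-(2 * x)) * (1 - exp (-(2 * x))) / (1 + exp (-(2 * x))) := by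
  rw [tanh_eq_one_sub, Real.exp_neg]
  have := Real.exp_pos (2 * x)
  field_simp
  ring

theorem integrableOn_exp_mul_tanh_div {c : ℝ} (hc : 0 < c) :
    IntegrableOn (fun x => exp (-(c * x)) * (tanh x / x)) (Ioi 0) := by
  have hi : IntegrableOn (fun x => exp (-c * x)) (Ioi 0) :=
    integrableOn_exp_mul_Ioi (by linarith) 0
  refine hi.mono' ?_ (ae_of_all _ fun x => ?_)
  · exact (Measurable.mul (by fun_prop) measurable_tanh_div).aestronglyMeasurable
  · rw [Real.norm_of_nonneg (mul_nonneg (Real.exp_pos _).le (tanh_div_nonneg x)), neg_mul]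
    exact mul_le_of_le_one_right (Real.exp_pos _).le (tanh_div_le_one x)

/-- With `q = exp (-2x)`, `tanh x = (1 - q)/(1 + q)`, so `q (1 - q²) tanh x = (q - q²) - (q² - q³)`.
Multiplied by `exp (-4nx)/x`, the two brackets are Frullani integrands, and their logarithms combine
to the next Wallis factor. -/
theorem integral_exp_mul_tanh_div_step (n : ℕ) :
    ∫ x in Ioi 0, exp (-((4 * n + 2 : ℝ) * x)) * (tanh x / x)
      = log ((2 * n + 2) / (2 * n + 1) * ((2 * n + 2) / (2 * n + 3)))
        + ∫ x in Ioi 0, exp (-((4 * (n + 1 : ℕ) + 2 : ℝ) * x)) * (tanh x / x) := by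
  have e1 := integral_exp_sub_exp_div (a := 4 * n + 2) (b := 4 * n + 4) (by positivity)
    (by linarith)
  have e2 := integral_exp_sub_exp_div (a := 4 * n + 4) (b := 4 * n + 6) (by positivity)
    (by linarith)
  have i1 := integrableOn_exp_sub_exp_div (a := 4 * n + 2) (b := 4 * n + 4) (by positivity)
    (by linarith)
  have i2 := integrableOn_exp_sub_exp_div (a := 4 * n + 4) (b := 4 * n + 6) (by positivity)
    (by linarith)
  have i3 := integrableOn_exp_mul_tanh_div (c := 4 * (n + 1 : ℕ) + 2) (by positivity)
  have hl : log ((2 * n + 2) / (2 * n + 1) * ((2 * n + 2) / (2 * n + 3)) : ℝ)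
      = log ((4 * n + 4) / (4 * n + 2) : ℝ) - log ((4 * n + 6) / (4 * n + 4) : ℝ) := by
    rw [← Real.log_div (by positivity) (by positivity)]
    congr 1
    field_simp
    ring
  have i12 : IntegrableOn (fun x : ℝ => x⁻¹ * (exp (-((4 * n + 2) * x)) - exp (-((4 * n + 4) * x)))
      - x⁻¹ * (exp (-((4 * n + 4) * x)) - exp (-((4 * n + 6) * x)))) (Ioi 0) := i1.sub i2
  rw [hl, ← e1, ← e2, ← integral_sub i1 i2, ← integral_add i12 i3]
  refine setIntegral_congr_fun measurableSet_Ioi fun x hx => ?_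
  have hx : x ≠ 0 := (mem_Ioi.1 hx).ne'
  have hq := Real.exp_pos (-(2 * x))
  have h2 : exp (-((4 * n + 2 : ℝ) * x)) = exp (-(4 * n * x)) * exp (-(2 * x)) := by
    rw [← Real.exp_add]; ring_nf
  have h4 : exp (-((4 * n + 4 : ℝ) * x)) = exp (-(4 * n * x)) * exp (-(2 * x)) ^ 2 := by
    rw [← Real.exp_nat_mul, ← Real.exp_add]; push_cast; ring_nf
  have h6 : exp (-((4 * n + 6 : ℝ) * x)) = exp (-(4 * n * x)) * exp (-(2 * x)) ^ 3 := by
    rw [← Real.exp_nat_mul, ← Real.exp_add]; push_cast; ring_nf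
  have h7 : (4 * (n + 1 : ℕ) + 2 : ℝ) = 4 * n + 6 := by push_cast; ring
  have ht : tanh x = (1 - exp (-(2 * x))) / (1 + exp (-(2 * x))) := by
    have := exp_mul_tanh x
    rw [mul_div_assoc] at this
    exact mul_left_cancel₀ hq.ne' this
  simp only [h7, h2, h4, h6, ht]
  field_simp
  ring

theorem integral_exp_mul_tanh_div_eq_wallis (n : ℕ) :
    ∫ x in Ioi 0, exp (-(2 * x)) * (tanh x / x)
      = log (Real.Wallis.W n) + ∫ x in Ioi 0, exp (-((4 * n + 2 : ℝ) * x)) * (tanh x / x) := by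
  induction n with
  | zero => simp [Real.Wallis.W]
  | succ n ih =>
    rw [ih, integral_exp_mul_tanh_div_step, Real.Wallis.W_succ,
      Real.log_mul (Real.Wallis.W_pos n).ne' (by positivity), add_assoc]

theorem integral_exp_mul_tanh_div :
    ∫ x in Ioi 0, exp (-(2 * x)) * (tanh x / x) = log (π / 2) := by
  -- As `tanh x / x ≤ 1`, the remainder is at most `1 / (4n + 2)`.
  have hrem : Tendsto (fun n : ℕ => ∫ x in Ioi 0, exp (-((4 * n + 2 : ℝ) * x)) * (tanh x / x))
      atTop (𝓝 0) := by
    have hlim : Tendsto (fun n : ℕ => 1 / ((n : ℝ) + 1)) atTop (𝓝 0) :=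
      tendsto_one_div_add_atTop_nhds_zero_nat
    refine squeeze_zero (fun n => ?_) (fun n => ?_) hlim
    · exact integral_nonneg fun x => mul_nonneg (Real.exp_pos _).le (tanh_div_nonneg x)
    · have hi : IntegrableOn (fun x : ℝ => exp (-(4 * n + 2 : ℝ) * x)) (Ioi 0) :=
        integrableOn_exp_mul_Ioi (by linarith [Nat.cast_nonneg (α := ℝ) n]) 0
      calc ∫ x in Ioi 0, exp (-((4 * n + 2 : ℝ) * x)) * (tanh x / x)
          ≤ ∫ x in Ioi 0, exp (-(4 * n + 2 : ℝ) * x) := by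
            refine integral_mono (integrableOn_exp_mul_tanh_div (by positivity)) hi fun x => ?_
            simp only [neg_mul]
            exact mul_le_of_le_one_right (Real.exp_pos _).le (tanh_div_le_one x)
        _ = 1 / (4 * n + 2) := by
            rw [integral_exp_mul_Ioi (by linarith [Nat.cast_nonneg (α := ℝ) n])]
            rw [mul_zero, Real.exp_zero, div_neg, neg_div, neg_neg]
        _ ≤ 1 / (n + 1) := by
            gcongr 1 / ?_
            linarith [Nat.cast_nonneg (α := ℝ) n]
  have := tendsto_log_wallis.add hrem
  simp only [← integral_exp_mul_tanh_div_eq_wallis, add_zero] at this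
  exact tendsto_nhds_unique tendsto_const_nhds this

/-! ### Euler's constant from the integral of `(1 - exp (-t)) / t`. -/

/-- This is the integrand of the derivative at `s = 1` of the Mellin transform of `exp (-t)`, whose
convergence comes with Mellin differentiability. -/
theorem integrableOn_log_mul_exp_neg : IntegrableOn (fun t => log t * exp (-t)) (Ioi 0) := by
  have hc : Continuous fun x : ℝ => ((exp (-x) : ℝ) : ℂ) := by fun_prop
  have h := (mellin_hasDerivAt_of_isBigO_rpow (E := ℂ) (a := 2) (b := 0) (s := 1)
    (f := fun x : ℝ => ((exp (-x) : ℝ) : ℂ)) (hc.locallyIntegrable.locallyIntegrableOn _)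
    (by
      rw [← Asymptotics.isBigO_norm_left]
      simp_rw [Complex.norm_real, Asymptotics.isBigO_norm_left]
      simpa only [neg_one_mul] using (isLittleO_exp_neg_mul_rpow_atTop zero_lt_one _).isBigO)
    (by norm_num)
    (by
      simp_rw [neg_zero, Real.rpow_zero]
      exact Asymptotics.isBigO_const_of_tendsto
        ((hc.tendsto 0).mono_left nhdsWithin_le_nhds) (by simp))
    (by norm_num)).1
  have h2 := Integrable.re h
  refine IntegrableOn.congr_fun h2 (fun t _ => ?_) measurableSet_Ioi
  have : (Complex.exp (-(t : ℂ))).re = exp (-t) := by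
    rw [← Complex.ofReal_neg, Complex.exp_ofReal_re]
  simp [this]

/-- The integral is `Γ'(1)`, obtained by differentiating Euler's integral under the integral sign.
-/
theorem integral_log_mul_exp_neg :
    ∫ t in Ioi 0, log t * exp (-t) = -Real.eulerMascheroniConstant := by
  have h1 := Complex.hasDerivAt_GammaIntegral (s := 1) (by simp)
  have h2 : HasDerivAt Complex.GammaIntegral (-Real.eulerMascheroniConstant : ℂ) 1 := by
    refine Complex.hasDerivAt_Gamma_one.congr_of_eventuallyEq ?_
    have : ∀ᶠ s : ℂ in 𝓝 1, 0 < s.re :=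
      (Complex.continuous_re.tendsto 1).eventually (lt_mem_nhds (by simp))
    filter_upwards [this] with s hs
    rw [Complex.Gamma_eq_integral hs]
  have h3 := h1.unique h2
  simp only [sub_self, Complex.cpow_zero, one_mul] at h3
  have h4 : ∫ t : ℝ in Ioi 0, ((log t * exp (-t) : ℝ) : ℂ) = -Real.eulerMascheroniConstant := by
    rw [← h3]
    simp
  rw [integral_complex_ofReal] at h4
  exact_mod_cast h4

theorem one_sub_exp_neg_div_mem_Icc {t : ℝ} (ht : 0 ≤ t) : (1 - exp (-t)) / t ∈ Icc (0 : ℝ) 1 := by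
  have h2 : exp (-t) ≤ 1 := Real.exp_le_one_iff.2 (by linarith)
  have h3 := Real.one_sub_le_exp_neg t
  exact ⟨div_nonneg (by linarith) ht, div_le_one_of_le₀ (by linarith) ht⟩

theorem intervalIntegrable_one_sub_exp_neg_div {X : ℝ} (hX : 0 ≤ X) :
    IntervalIntegrable (fun t => (1 - exp (-t)) / t) volume 0 X := by
  rw [intervalIntegrable_iff_integrableOn_Ioc_of_le hX]
  refine (integrableOn_const (C := (1 : ℝ)) (by simp)).mono'
    (Measurable.div (by fun_prop) measurable_id).aestronglyMeasurable
    ((ae_restrict_mem measurableSet_Ioc).mono fun t ht => ?_)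
  have := one_sub_exp_neg_div_mem_Icc ht.1.le
  rw [Real.norm_of_nonneg this.1]
  exact this.2

/-- Integration by parts with primitive `(1 - exp (-t)) log t`. It is continuous at `0` because it
is bounded there by `|t log t|`. -/
theorem integral_one_sub_exp_neg_div {X : ℝ} (hX : 0 < X) :
    ∫ t in (0 : ℝ)..X, (1 - exp (-t)) / t
      = (1 - exp (-X)) * log X - ∫ t in (0 : ℝ)..X, log t * exp (-t) := by
  have i1 := intervalIntegrable_one_sub_exp_neg_div hX.le
  have i2 : IntervalIntegrable (fun t => log t * exp (-t)) volume 0 X :=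
    (intervalIntegrable_iff_integrableOn_Ioc_of_le hX.le).2
      (integrableOn_log_mul_exp_neg.mono_set Ioc_subset_Ioi_self)
  have hcont : ContinuousOn (fun t => (1 - exp (-t)) * log t) (Icc 0 X) := by
    intro t ht
    rcases ht.1.eq_or_lt with h | h
    · subst h
      have hz : Tendsto (fun t : ℝ => |t * log t|) (𝓝[Icc 0 X] 0) (𝓝 0) := by
        have := (Real.continuous_mul_log.abs.tendsto 0).mono_left
          (nhdsWithin_le_nhds (s := Icc 0 X))
        simpa using this
      have : Tendsto (fun t : ℝ => (1 - exp (-t)) * log t) (𝓝[Icc 0 X] 0) (𝓝 0) := by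
        refine squeeze_zero_norm' ?_ hz
        filter_upwards [self_mem_nhdsWithin] with t ht
        have h2 : exp (-t) ≤ 1 := Real.exp_le_one_iff.2 (by linarith [ht.1])
        have h3 := Real.one_sub_le_exp_neg t
        rw [Real.norm_eq_abs, abs_mul, abs_mul, abs_of_nonneg ht.1,
          abs_of_nonneg (a := 1 - exp (-t)) (by linarith)]
        gcongr
        linarith
      simpa [ContinuousWithinAt] using this
    · exact ((by fun_prop : ContinuousAt (fun t : ℝ => 1 - exp (-t)) t).mul
        (Real.continuousAt_log h.ne')).continuousWithinAt
  have := intervalIntegral.integral_eq_sub_of_hasDerivAt_of_le hX.le hcont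
    (f' := fun t => log t * exp (-t) + (1 - exp (-t)) / t) (fun t ht => by
      have h1 : HasDerivAt (fun t : ℝ => 1 - exp (-t)) (exp (-t)) t := by
        simpa using (hasDerivAt_neg t).exp.const_sub 1
      exact (h1.mul (Real.hasDerivAt_log ht.1.ne')).congr_deriv (by ring)) (i2.add i1)
  rw [intervalIntegral.integral_add i2 i1] at this
  simp only [neg_zero, Real.exp_zero, sub_self, zero_mul, sub_zero] at this
  linarith

theorem tendsto_integral_one_sub_exp_neg_div :
    Tendsto (fun X => (∫ t in (0 : ℝ)..X, (1 - exp (-t)) / t) - log X) atTop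
      (𝓝 Real.eulerMascheroniConstant) := by
  have h1 : Tendsto (fun X => ∫ t in (0 : ℝ)..X, log t * exp (-t)) atTop
      (𝓝 (-Real.eulerMascheroniConstant)) := by
    rw [← integral_log_mul_exp_neg]
    exact intervalIntegral_tendsto_integral_Ioi 0 integrableOn_log_mul_exp_neg tendsto_id
  have h2 : Tendsto (fun X : ℝ => exp (-X) * log X) atTop (𝓝 0) := by
    have hz := Real.tendsto_pow_mul_exp_neg_atTop_nhds_zero 1
    refine squeeze_zero_norm' ?_ hz
    filter_upwards [eventually_ge_atTop 1] with X hX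
    rw [Real.norm_of_nonneg (mul_nonneg (Real.exp_pos _).le (Real.log_nonneg hX)), mul_comm,
      pow_one]
    gcongr
    linarith [Real.log_le_sub_one_of_pos (x := X) (by linarith)]
  have h3 := h2.neg.sub h1
  rw [neg_zero, zero_sub, neg_neg] at h3
  refine h3.congr' ?_
  filter_upwards [eventually_gt_atTop 0] with X hX
  rw [integral_one_sub_exp_neg_div hX]
  ring

/-! ### Growth of the integral of `tanh x / x`. -/

/-- Pointwise `tanh x = (1 - exp (-2x)) - exp (-2x) tanh x`. The first term carries the logarithm
and `γ`, the second converges to `log (π / 2)`. -/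
theorem integral_tanh_div_eq {X : ℝ} (hX : 0 < X) :
    ∫ x in (0 : ℝ)..X, tanh x / x
      = (∫ t in (0 : ℝ)..2 * X, (1 - exp (-t)) / t)
        - ∫ x in (0 : ℝ)..X, exp (-(2 * x)) * (tanh x / x) := by
  have i1 : IntervalIntegrable (fun x => exp (-(2 * x)) * (tanh x / x)) volume 0 X :=
    (intervalIntegrable_iff_integrableOn_Ioc_of_le hX.le).2
      ((integrableOn_exp_mul_tanh_div two_pos).mono_set Ioc_subset_Ioi_self)
  have h1 : ∫ t in (0 : ℝ)..2 * X, (1 - exp (-t)) / t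
      = ∫ x in (0 : ℝ)..X, (tanh x / x + exp (-(2 * x)) * (tanh x / x)) := by
    have := intervalIntegral.mul_integral_comp_mul_left (a := 0) (b := X)
      (f := fun t => (1 - exp (-t)) / t) (2 : ℝ)
    rw [mul_zero] at this
    rw [← this, ← intervalIntegral.integral_const_mul]
    refine intervalIntegral.integral_congr fun x _ => ?_
    have hq := Real.exp_pos (2 * x)
    simp only [tanh_eq_one_sub, Real.exp_neg]
    rcases eq_or_ne x 0 with rfl | hx
    · simp
    · field_simp
      ring
  rw [h1, intervalIntegral.integral_add (intervalIntegrable_tanh_div 0 X) i1]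
  ring

theorem tendsto_integral_tanh_div_sub_log :
    Tendsto (fun X => (∫ x in (0 : ℝ)..X, tanh x / x) - log X) atTop
      (𝓝 (log (4 / π) + Real.eulerMascheroniConstant)) := by
  have h1 := tendsto_integral_one_sub_exp_neg_div.comp
    (tendsto_id.const_mul_atTop (two_pos : (0 : ℝ) < 2))
  have h2 : Tendsto (fun X => ∫ x in (0 : ℝ)..X, exp (-(2 * x)) * (tanh x / x)) atTop
      (𝓝 (log (π / 2))) := by
    rw [← integral_exp_mul_tanh_div]
    exact intervalIntegral_tendsto_integral_Ioi 0 (integrableOn_exp_mul_tanh_div two_pos)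
      tendsto_id
  have h3 := (h1.sub h2).add_const (log 2)
  have h4 : Real.eulerMascheroniConstant - log (π / 2) + log 2
      = log (4 / π) + Real.eulerMascheroniConstant := by
    rw [Real.log_div (by positivity) (by positivity), Real.log_div (by positivity) (by positivity),
      show (4 : ℝ) = 2 * 2 by norm_num, Real.log_mul (by positivity) (by positivity)]
    ring
  rw [h4] at h3
  refine h3.congr' ?_
  filter_upwards [eventually_gt_atTop 0] with X hX
  simp only [Function.comp, id]
  rw [integral_tanh_div_eq hX, Real.log_mul two_ne_zero hX.ne']
  ring

/-- The growth of `∫₀ˣ tanh x / x dx`, with an explicit error term. -/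
theorem abs_integral_tanh_div_sub_le {X : ℝ} (hX : 0 < X) :
    |(∫ x in (0 : ℝ)..X, tanh x / x) - log X - (log (4 / π) + Real.eulerMascheroniConstant)|
      ≤ 1 / X ^ 2 := by
  set c := log (4 / π) + Real.eulerMascheroniConstant
  have hlim : Tendsto (fun Y => |(∫ x in (0 : ℝ)..X, tanh x / x) - log X
      - ((∫ x in (0 : ℝ)..Y, tanh x / x) - log Y)|) atTop
      (𝓝 |(∫ x in (0 : ℝ)..X, tanh x / x) - log X - c|) :=
    (tendsto_integral_tanh_div_sub_log.const_sub _).abs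
  -- Comparing `X` with `Y > X` leaves `∫_X^Y (1 - tanh x)/x dx`, dominated by `∫_X^Y x⁻³ dx ≤ 1 /
  -- (2X²)`.
  refine le_of_tendsto hlim ?_
  filter_upwards [eventually_gt_atTop X] with Y hY
  have hne : ∀ x ∈ uIcc X Y, x ≠ 0 := fun x hx => by
    rw [uIcc_of_le hY.le] at hx
    exact (hX.trans_le hx.1).ne'
  have e1 : (∫ x in (0 : ℝ)..X, tanh x / x) - log X - ((∫ x in (0 : ℝ)..Y, tanh x / x) - log Y)
      = ∫ x in X..Y, (1 / x - tanh x / x) := by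
    rw [intervalIntegral.integral_sub (intervalIntegral.intervalIntegrable_one_div hne
      continuousOn_id) (intervalIntegrable_tanh_div _ _), integral_one_div_of_pos hX (hX.trans hY),
      Real.log_div (hX.trans hY).ne' hX.ne', ← intervalIntegral.integral_add_adjacent_intervals
        (intervalIntegrable_tanh_div 0 X) (intervalIntegrable_tanh_div X Y)]
    ring
  have hd : ∀ x ∈ uIcc X Y, HasDerivAt (fun x : ℝ => -(1 / 2) * (x ^ 2)⁻¹) (1 / x ^ 3) x :=
    fun x hx => by
    have := hne x hx
    refine (((hasDerivAt_pow 2 x).inv (pow_ne_zero 2 this)).const_mul (-(1 / 2) : ℝ)).congr_deriv ?_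
    field_simp
    norm_num
  have hi : IntervalIntegrable (fun x : ℝ => 1 / x ^ 3) volume X Y :=
    ContinuousOn.intervalIntegrable (continuousOn_const.div (by fun_prop)
      fun x hx => pow_ne_zero 3 (hne x hx))
  have e2 := intervalIntegral.integral_eq_sub_of_hasDerivAt hd hi
  have hb : ‖∫ x in X..Y, (1 / x - tanh x / x)‖ ≤ ∫ x in X..Y, 1 / x ^ 3 := by
    refine intervalIntegral.norm_integral_le_of_norm_le hY.le (ae_of_all _ fun x hx => ?_) hi
    have hx0 : 0 < x := hX.trans hx.1
    rw [← sub_div, Real.norm_of_nonneg (div_nonneg (one_sub_tanh_nonneg x) hx0.le), pow_succ,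
      ← div_div]
    gcongr
    exact one_sub_tanh_le_inv_sq hx0
  rw [e1, ← Real.norm_eq_abs]
  refine hb.trans ?_
  rw [e2]
  have : 0 < Y ^ 2 := by have := hX.trans hY; positivity
  have : 0 < X ^ 2 := by positivity
  have h1 : 0 < (Y ^ 2)⁻¹ := by positivity
  have h2 : 0 < (X ^ 2)⁻¹ := by positivity
  rw [one_div (X ^ 2)]
  linarith

/-! ### The arcsine law of a single hopping term. -/

/-- The normalized measure `dk / 2π` on `[-π, π]`. -/
def circleMeasure : Measure ℝ :=
  ENNReal.ofReal ((2 * π)⁻¹) • volume.restrict (Icc (-π) π)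

/-- The distribution of `-2 cos k` under `dk / 2π`. -/
def arcsineLaw : Measure ℝ := circleMeasure.map fun k => -2 * cos k

/-- The Lebesgue density of `arcsineLaw`; it vanishes off `(-2, 2)`. -/
def arcsineDensity (x : ℝ) : ℝ := (π * √(4 - x ^ 2))⁻¹

instance : IsProbabilityMeasure circleMeasure := by
  constructor
  rw [circleMeasure, Measure.smul_apply, Measure.restrict_apply_univ, Real.volume_Icc, smul_eq_mul,
    ← ENNReal.ofReal_mul (by positivity), ← ENNReal.ofReal_one]
  congr 1
  field_simp
  ring

theorem measurable_neg_two_mul_cos : Measurable fun k : ℝ => -2 * cos k := by fun_prop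

instance : IsProbabilityMeasure arcsineLaw :=
  Measure.isProbabilityMeasure_map measurable_neg_two_mul_cos.aemeasurable

theorem momentumMeasure_eq_pi : momentumMeasure = Measure.pi fun _ : Fin 3 => circleMeasure := by
  refine (Measure.pi_eq fun s hs => ?_).symm
  have h1 : univ.pi s ∩ momentumCube = univ.pi fun i => s i ∩ Icc (-π) π := by
    rw [momentumCube, ← pi_univ_Icc, pi_inter_distrib]
  rw [momentumMeasure, Measure.smul_apply, Measure.restrict_apply (MeasurableSet.univ_pi hs), h1,
    volume_pi_pi]
  simp only [circleMeasure, Measure.smul_apply, smul_eq_mul, Measure.restrict_apply (hs _)]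
  rw [Finset.prod_mul_distrib, Finset.prod_const, Finset.card_univ, Fintype.card_fin,
    ← ENNReal.ofReal_pow (by positivity), inv_pow]

theorem arcsineDensity_nonneg (x : ℝ) : 0 ≤ arcsineDensity x := by
  unfold arcsineDensity; positivity

theorem arcsineDensity_neg (x : ℝ) : arcsineDensity (-x) = arcsineDensity x := by
  simp [arcsineDensity]

theorem measurable_arcsineDensity : Measurable arcsineDensity := by
  unfold arcsineDensity; fun_prop

theorem arcsineDensity_of_two_le {x : ℝ} (hx : 2 ≤ |x|) : arcsineDensity x = 0 := by
  have : 4 - x ^ 2 ≤ 0 := by nlinarith [sq_abs x]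
  simp [arcsineDensity, Real.sqrt_eq_zero_of_nonpos this]

/-- Change of variables on the half period where `cos` is injective. The factor `π` is the length of
that half period, since `dk` is not normalized here. -/
theorem setLIntegral_comp_cos (g : ℝ → ℝ≥0∞) :
    ∫⁻ k in Ioo 0 π, g (-2 * cos k) = ∫⁻ y, ENNReal.ofReal (π * arcsineDensity y) * g y := by
  have himg : (fun k => -2 * cos k) '' Ioo 0 π = Ioo (-2) 2 := by
    ext y
    constructor
    · rintro ⟨k, hk, rfl⟩
      have h1 := Real.cos_lt_cos_of_nonneg_of_le_pi le_rfl hk.2.le hk.1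
      have h2 := Real.cos_lt_cos_of_nonneg_of_le_pi hk.1.le le_rfl hk.2
      rw [Real.cos_zero] at h1
      rw [Real.cos_pi] at h2
      constructor <;> simp only <;> linarith
    · rintro ⟨h1, h2⟩
      refine ⟨arccos (-y / 2), ⟨Real.arccos_pos.2 (by linarith), ?_⟩, ?_⟩
      · exact (Real.arccos_le_pi _).lt_of_ne fun h => by
          have := Real.arccos_eq_pi.1 h
          linarith
      · simp only
        rw [Real.cos_arccos (by linarith) (by linarith)]
        ring
  have h := lintegral_image_eq_lintegral_abs_deriv_mul (s := Ioo 0 π) (f := fun k => -2 * cos k)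
    (f' := fun k => 2 * sin k) measurableSet_Ioo
    (fun x _ => (((Real.hasDerivAt_cos x).const_mul (-2)).congr_deriv (by ring)).hasDerivWithinAt)
    (fun x hx y hy hxy => Real.injOn_cos (Ioo_subset_Icc_self hx) (Ioo_subset_Icc_self hy)
      (by simpa using hxy))
    (fun y => ENNReal.ofReal (π * arcsineDensity y) * g y)
  rw [himg] at h
  have h2 : ∫⁻ y in Ioo (-2) 2, ENNReal.ofReal (π * arcsineDensity y) * g y
      = ∫⁻ y, ENNReal.ofReal (π * arcsineDensity y) * g y := by
    refine setLIntegral_eq_of_support_subset fun y hy => ?_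
    by_contra hy2
    refine hy ?_
    have : 2 ≤ |y| := by
      by_contra h3
      exact hy2 (abs_lt.1 (not_le.1 h3))
    simp [arcsineDensity_of_two_le this]
  rw [← h2, h]
  refine setLIntegral_congr_fun measurableSet_Ioo fun k hk => ?_
  have hs := Real.sin_pos_of_mem_Ioo hk
  have h3 : √(4 - (-2 * cos k) ^ 2) = 2 * sin k := by
    rw [← Real.sqrt_sq (by positivity : 0 ≤ 2 * sin k)]
    congr 1
    nlinarith [Real.sin_sq_add_cos_sq k]
  rw [← mul_assoc, ← ENNReal.ofReal_mul (abs_nonneg _), abs_of_pos (by positivity), arcsineDensity,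
    h3]
  have : 2 * sin k * (π * (π * (2 * sin k))⁻¹) = 1 := by field_simp
  rw [this, ENNReal.ofReal_one, one_mul]

theorem lintegral_arcsineLaw {g : ℝ → ℝ≥0∞} (hg : Measurable g) :
    ∫⁻ x, g x ∂arcsineLaw = ∫⁻ x, ENNReal.ofReal (arcsineDensity x) * g x := by
  have hm : Measurable fun k : ℝ => g (-2 * cos k) := hg.comp measurable_neg_two_mul_cos
  rw [arcsineLaw, lintegral_map hg measurable_neg_two_mul_cos, circleMeasure, lintegral_smul_measure,
    smul_eq_mul]
  have h0 : ∫⁻ k in Icc (-π) π, g (-2 * cos k)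
      = (∫⁻ k in Ioc (-π) 0, g (-2 * cos k)) + ∫⁻ k in Ioc 0 π, g (-2 * cos k) := by
    rw [← lintegral_union measurableSet_Ioc (Ioc_disjoint_Ioc_of_le le_rfl),
      Ioc_union_Ioc_eq_Ioc (by linarith [Real.pi_pos]) Real.pi_pos.le]
    exact setLIntegral_congr Ioc_ae_eq_Icc.symm
  have h1 : ∫⁻ k in Ioo (-π) 0, g (-2 * cos k) = ∫⁻ k in Ioo 0 π, g (-2 * cos k) := by
    have := (Measure.measurePreserving_neg (volume : Measure ℝ)).setLIntegral_comp_preimage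
      (measurableSet_Ioo (a := (0 : ℝ)) (b := π)) hm
    simpa using this
  rw [h0, setLIntegral_congr Ioo_ae_eq_Ioc.symm,
    setLIntegral_congr (Ioo_ae_eq_Ioc (a := (0 : ℝ))).symm, h1, setLIntegral_comp_cos, ← two_mul,
    ← mul_assoc, ← ENNReal.ofReal_ofNat, ← ENNReal.ofReal_mul (by positivity),
    ← lintegral_const_mul' _ _ ENNReal.ofReal_ne_top]
  refine lintegral_congr fun y => ?_
  rw [← mul_assoc, ← ENNReal.ofReal_mul (by positivity)]
  congr 2
  have := arcsineDensity_nonneg y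
  field_simp

theorem arcsineLaw_eq_withDensity :
    arcsineLaw = volume.withDensity fun x => ENNReal.ofReal (arcsineDensity x) := by
  refine Measure.ext_of_lintegral _ fun f hf => ?_
  rw [lintegral_arcsineLaw hf,
    lintegral_withDensity_eq_lintegral_mul _ measurable_arcsineDensity.ennreal_ofReal hf]
  rfl

theorem lintegral_arcsineLaw_comp_neg {g : ℝ → ℝ≥0∞} (hg : Measurable g) :
    ∫⁻ x, g (-x) ∂arcsineLaw = ∫⁻ x, g x ∂arcsineLaw := by
  rw [lintegral_arcsineLaw hg, lintegral_arcsineLaw (g := fun x => g (-x)) (hg.comp measurable_neg)]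
  have := (Measure.measurePreserving_neg (volume : Measure ℝ)).lintegral_comp
    (f := fun x => ENNReal.ofReal (arcsineDensity x) * g x)
    (measurable_arcsineDensity.ennreal_ofReal.mul hg)
  simpa [arcsineDensity_neg] using this

theorem ae_arcsineLaw_abs_le : ∀ᵐ x ∂arcsineLaw, |x| ≤ 2 := by
  rw [arcsineLaw, ae_map_iff measurable_neg_two_mul_cos.aemeasurable
    (measurableSet_le measurable_abs measurable_const)]
  refine ae_of_all _ fun k => ?_
  rw [abs_mul, abs_neg, abs_two]
  linarith [Real.abs_cos_le_one k]

theorem arcsineLaw_absolutelyContinuous : arcsineLaw ≪ volume := by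
  rw [arcsineLaw_eq_withDensity]
  exact withDensity_absolutelyContinuous _ _

/-- Serves the lower bound on `N(0)`: the radius `1/3` ensures `|x + t y| ≤ 1` for `x, y` in the
interval and `0 < t < 2`. -/
theorem arcsineLaw_real_Icc_pos : 0 < arcsineLaw.real (Icc (-(1 / 3)) (1 / 3)) := by
  rw [measureReal_def, ENNReal.toReal_pos_iff]
  refine ⟨?_, measure_lt_top _ _⟩
  rw [arcsineLaw_eq_withDensity, withDensity_apply _ measurableSet_Icc]
  refine (setLIntegral_pos_iff measurable_arcsineDensity.ennreal_ofReal).2 ?_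
  have : Icc (-(1 / 3) : ℝ) (1 / 3) ⊆ Function.support fun x =>
      ENNReal.ofReal (arcsineDensity x) := fun x hx => by
    have h1 : 0 < 4 - x ^ 2 := by nlinarith [hx.1, hx.2]
    have : 0 < arcsineDensity x := by unfold arcsineDensity; positivity
    simpa using this
  rw [inter_eq_self_of_subset_right this, Real.volume_Icc]
  norm_num

/-! ### The law of the band energy: density and symmetry. -/

/-- The distribution of the band energy. -/
def bandLaw (tz : ℝ) : Measure ℝ := momentumMeasure.map (band tz)

theorem measurable_band (tz : ℝ) : Measurable (band tz) := by
  unfold band; fun_prop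

instance : IsProbabilityMeasure momentumMeasure := by
  rw [momentumMeasure_eq_pi]; infer_instance

instance (tz : ℝ) : IsProbabilityMeasure (bandLaw tz) :=
  Measure.isProbabilityMeasure_map (measurable_band tz).aemeasurable

theorem map_momentumMeasure_cos :
    momentumMeasure.map (fun k i => -2 * cos (k i)) = Measure.pi fun _ => arcsineLaw := by
  rw [momentumMeasure_eq_pi]
  exact (Measure.pi_map_pi fun _ => measurable_neg_two_mul_cos.aemeasurable)

theorem lintegral_bandLaw (tz : ℝ) {f : ℝ → ℝ≥0∞} (hf : Measurable f) :
    ∫⁻ e, f e ∂bandLaw tz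
      = ∫⁻ x, ∫⁻ y, ∫⁻ z, f (x + y + tz * z) ∂arcsineLaw ∂arcsineLaw ∂arcsineLaw := by
  have h1 : ∫⁻ e, f e ∂bandLaw tz
      = ∫⁻ v : Fin 3 → ℝ, f (v 0 + v 1 + tz * v 2) ∂(Measure.pi fun _ => arcsineLaw) := by
    rw [← map_momentumMeasure_cos, bandLaw, lintegral_map hf (measurable_band tz),
      lintegral_map (by fun_prop) (by fun_prop)]
    refine lintegral_congr fun k => ?_
    congr 1
    unfold band
    ring
  rw [h1]
  have e1 := (measurePreserving_piFinSuccAbove (fun _ : Fin 3 => arcsineLaw) 0).symm.lintegral_comp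
    (f := fun v : Fin 3 → ℝ => f (v 0 + v 1 + tz * v 2)) (by fun_prop)
  rw [← e1, lintegral_prod _ (by
    refine Measurable.aemeasurable ?_
    exact Measurable.comp (g := fun v : Fin 3 → ℝ => f (v 0 + v 1 + tz * v 2)) (by fun_prop)
      (MeasurableEquiv.measurable _))]
  refine lintegral_congr fun x => ?_
  have e2 := (measurePreserving_finTwoArrow arcsineLaw).lintegral_comp
    (f := fun p : ℝ × ℝ => f (x + p.1 + tz * p.2)) (by fun_prop)
  rw [lintegral_prod _ (by fun_prop)] at e2
  rw [← e2]
  rfl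

/-- With `x` and `z` frozen, the energy is a translate of `y`, whose law has a density; this needs
nothing of `tz`. -/
theorem bandLaw_absolutelyContinuous (tz : ℝ) : bandLaw tz ≪ volume := by
  refine Measure.AbsolutelyContinuous.mk fun s hs h0 => ?_
  have hm : Measurable (s.indicator (1 : ℝ → ℝ≥0∞)) := measurable_one.indicator hs
  rw [← lintegral_indicator_one hs, lintegral_bandLaw tz hm]
  have hswap : ∀ x : ℝ, ∫⁻ y, ∫⁻ z, s.indicator (1 : ℝ → ℝ≥0∞) (x + y + tz * z)
      ∂arcsineLaw ∂arcsineLaw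
      = 0 := fun x => by
    rw [lintegral_lintegral_swap (by fun_prop)]
    refine (lintegral_congr fun z => ?_).trans lintegral_zero
    have h1 : (fun y : ℝ => s.indicator (1 : ℝ → ℝ≥0∞) (x + y + tz * z))
        = ((fun y : ℝ => y + (x + tz * z)) ⁻¹' s).indicator 1 := by
      ext y
      rw [show x + y + tz * z = y + (x + tz * z) by ring]
      rfl
    have h2 : MeasurableSet ((fun y : ℝ => y + (x + tz * z)) ⁻¹' s) :=
      (measurable_add_const _) hs
    rw [h1, lintegral_indicator_one h2]
    refine arcsineLaw_absolutelyContinuous ?_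
    rw [measure_preimage_add_right]
    exact h0
  simp [hswap]

instance (tz : ℝ) : NullSingletonClass (bandLaw tz) :=
  ⟨fun x => bandLaw_absolutelyContinuous tz (measure_singleton x)⟩

theorem integratedDensity_eq (tz e : ℝ) : integratedDensity tz e = (bandLaw tz).real (Iic e) := by
  rw [bandLaw, map_measureReal_apply (measurable_band tz) measurableSet_Iic]
  rfl

theorem integratedDensity_eq_cdf (tz : ℝ) :
    integratedDensity tz = ProbabilityTheory.cdf (bandLaw tz) := by
  ext e
  rw [integratedDensity_eq, ProbabilityTheory.cdf_eq_real]

theorem monotone_integratedDensity (tz : ℝ) : Monotone (integratedDensity tz) := by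
  rw [integratedDensity_eq_cdf]
  exact ProbabilityTheory.monotone_cdf _

theorem densityOfStates_nonneg (tz e : ℝ) : 0 ≤ densityOfStates tz e :=
  (monotone_integratedDensity tz).deriv_nonneg

theorem measurable_densityOfStates (tz : ℝ) : Measurable (densityOfStates tz) :=
  measurable_deriv _

/-- By Lebesgue differentiation the distribution function is differentiable almost everywhere, with
derivative the Radon–Nikodym density. Default values of `deriv` therefore matter only on a null set.
-/
theorem bandLaw_eq_withDensity (tz : ℝ) :
    bandLaw tz = volume.withDensity fun e => ENNReal.ofReal (densityOfStates tz e) := by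
  conv_lhs => rw [← Measure.withDensity_rnDeriv_eq _ _ (bandLaw_absolutelyContinuous tz)]
  refine withDensity_congr_ae ?_
  have h := StieltjesFunction.ae_hasDerivAt (ProbabilityTheory.cdf (bandLaw tz))
  rw [ProbabilityTheory.measure_cdf] at h
  filter_upwards [h, Measure.rnDeriv_lt_top (bandLaw tz) volume] with e he hlt
  rw [densityOfStates, integratedDensity_eq_cdf, he.deriv, ENNReal.ofReal_toReal hlt.ne]

theorem lintegral_bandLaw_comp_neg (tz : ℝ) {f : ℝ → ℝ≥0∞} (hf : Measurable f) :
    ∫⁻ e, f (-e) ∂bandLaw tz = ∫⁻ e, f e ∂bandLaw tz := by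
  rw [lintegral_bandLaw tz hf, lintegral_bandLaw tz (f := fun e => f (-e)) (hf.comp measurable_neg)]
  rw [← lintegral_arcsineLaw_comp_neg (g := fun x => ∫⁻ y, ∫⁻ z, f (x + y + tz * z)
    ∂arcsineLaw ∂arcsineLaw) (by fun_prop)]
  refine lintegral_congr fun x => ?_
  rw [← lintegral_arcsineLaw_comp_neg (g := fun y => ∫⁻ z, f (-x + y + tz * z)
    ∂arcsineLaw) (by fun_prop)]
  refine lintegral_congr fun y => ?_
  rw [← lintegral_arcsineLaw_comp_neg (g := fun z => f (-x + -y + tz * z)) (by fun_prop)]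
  refine lintegral_congr fun z => ?_
  congr 1
  ring

theorem integratedDensity_neg (tz e : ℝ) :
    integratedDensity tz (-e) = 1 - integratedDensity tz e := by
  have h1 : bandLaw tz (Iic (-e)) = bandLaw tz (Ici e) := by
    have := lintegral_bandLaw_comp_neg tz (f := (Ici e).indicator 1)
      (measurable_one.indicator measurableSet_Ici)
    rw [lintegral_indicator_one measurableSet_Ici] at this
    rw [← this, ← lintegral_indicator_one measurableSet_Iic]
    refine lintegral_congr fun x => ?_
    simp only [indicator, mem_Iic, mem_Ici, le_neg, Pi.one_apply]
  rw [integratedDensity_eq, integratedDensity_eq, ← probReal_compl_eq_one_sub measurableSet_Iic,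
    compl_Iic, measureReal_def, h1, measureReal_def, measure_congr Ioi_ae_eq_Ici]

/-- Valid at every `e`, even without differentiability, since the rules for `deriv` used here
respect its default value. -/
theorem densityOfStates_neg (tz e : ℝ) : densityOfStates tz (-e) = densityOfStates tz e := by
  have h1 : integratedDensity tz = fun e => 1 - integratedDensity tz (-e) := by
    ext e
    rw [integratedDensity_neg]
    ring
  unfold densityOfStates
  conv_rhs => rw [h1]
  rw [deriv_const_sub, deriv_comp_neg, neg_neg]

theorem lintegral_densityOfStates (tz : ℝ) :
    ∫⁻ e, ENNReal.ofReal (densityOfStates tz e) = 1 := by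
  have := measure_univ (μ := bandLaw tz)
  rwa [bandLaw_eq_withDensity, withDensity_apply _ MeasurableSet.univ, setLIntegral_univ] at this

theorem integrable_densityOfStates (tz : ℝ) : Integrable (densityOfStates tz) := by
  refine ⟨(measurable_densityOfStates tz).aestronglyMeasurable, ?_⟩
  rw [hasFiniteIntegral_iff_ofReal (ae_of_all _ (densityOfStates_nonneg tz)),
    lintegral_densityOfStates]
  exact ENNReal.one_lt_top

theorem integral_densityOfStates (tz : ℝ) : ∫ e, densityOfStates tz e = 1 := by
  rw [integral_eq_lintegral_of_nonneg_ae (ae_of_all _ (densityOfStates_nonneg tz))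
    (measurable_densityOfStates tz).aestronglyMeasurable, lintegral_densityOfStates]
  rfl

theorem integral_bandLaw (tz : ℝ) (g : ℝ → ℝ) :
    ∫ e, g e ∂bandLaw tz = ∫ e, densityOfStates tz e * g e := by
  rw [bandLaw_eq_withDensity, integral_withDensity_eq_integral_toReal_smul
    (measurable_densityOfStates tz).ennreal_ofReal (ae_of_all _ fun _ => ENNReal.ofReal_lt_top)]
  simp [ENNReal.toReal_ofReal (densityOfStates_nonneg tz _)]

theorem abs_band_le {tz : ℝ} (htz : 0 ≤ tz) (k : Fin 3 → ℝ) : |band tz k| ≤ 4 + 2 * tz := by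
  have h0 := abs_le.1 (Real.abs_cos_le_one (k 0))
  have h1 := abs_le.1 (Real.abs_cos_le_one (k 1))
  have h2 := abs_le.1 (Real.abs_cos_le_one (k 2))
  unfold band
  rw [abs_le]
  constructor <;> nlinarith

theorem densityOfStates_eq_zero {tz e : ℝ} (htz : 0 ≤ tz) (he : 4 + 2 * tz < |e|) :
    densityOfStates tz e = 0 := by
  wlog h : e < 0 generalizing e
  · rw [← densityOfStates_neg]
    exact this (by rwa [abs_neg]) (by grind)
  rw [abs_of_neg h] at he
  have : integratedDensity tz =ᶠ[𝓝 e] fun _ => 0 := by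
    filter_upwards [Iio_mem_nhds (show e < -(4 + 2 * tz) by linarith)] with x hx
    have : {k | band tz k ≤ x} = ∅ := by
      ext k
      simp only [mem_ofPred_eq, mem_empty_iff_false, iff_false, not_le]
      rw [mem_Iio] at hx
      linarith [(abs_le.1 (abs_band_le htz k)).1]
    rw [integratedDensity, this, measureReal_empty]
  rw [densityOfStates, this.deriv_eq, deriv_const]

/-- Integrals of even functions of the band energy, in terms of the density of states. -/
theorem integral_bandLaw_of_even {tz : ℝ} (htz : 0 < tz) {g : ℝ → ℝ} (hg : ∀ e, g (-e) = g e) :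
    ∫ e, g e ∂bandLaw tz = ∫ e in (0 : ℝ)..(4 + 2 * tz), 2 * (densityOfStates tz e * g e) := by
  have h1 : ∀ e, densityOfStates tz |e| * g |e| = densityOfStates tz e * g e := fun e => by
    rcases abs_choice e with h | h <;> rw [h]
    rw [hg, densityOfStates_neg]
  rw [integral_bandLaw, ← funext h1, integral_comp_abs (f := fun e => densityOfStates tz e * g e),
    intervalIntegral.integral_const_mul, intervalIntegral.integral_of_le (by linarith)]
  congr 1
  refine setIntegral_eq_of_subset_of_forall_sdiff_eq_zero measurableSet_Ioi Ioc_subset_Ioi_self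
    fun e he => ?_
  have : 4 + 2 * tz < |e| := by
    rw [abs_of_pos he.1]
    by_contra h
    exact he.2 ⟨he.1, not_lt.1 h⟩
  rw [densityOfStates_eq_zero htz.le this, zero_mul]

theorem setIntegral_momentumCube_band (tz : ℝ) {g : ℝ → ℝ} (hg : Measurable g) :
    ∫ k in momentumCube, g (band tz k) * ((2 * π) ^ 3)⁻¹ = ∫ e, g e ∂bandLaw tz := by
  rw [bandLaw, integral_map (measurable_band tz).aemeasurable hg.aestronglyMeasurable,
    momentumMeasure, integral_smul_measure, ENNReal.toReal_ofReal (by positivity), integral_mul_const,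
    smul_eq_mul, mul_comm]

/-! ### Localization away from the edges of the arcsine law. -/

/-- The `t`-derivative of `f (x + t) + f (x - t)` is at most `2M|h|` for `|t| ≤ |h|`; the mean value
inequality gives the rest. -/
theorem abs_second_difference_le {f : ℝ → ℝ} {M : NNReal} (hf : Differentiable ℝ f)
    (hM : LipschitzWith M (deriv f)) (x h : ℝ) :
    |f (x + h) + f (x - h) - 2 * f x| ≤ 2 * M * h ^ 2 := by
  have hd : ∀ t, HasDerivAt (fun t => f (x + t) + f (x - t)) (deriv f (x + t) - deriv f (x - t)) t :=
    fun t => by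
      have h1 := (hf (x + t)).hasDerivAt.comp_const_add x t
      have h2 := (hf (x - t)).hasDerivAt.comp_const_sub x t
      exact (h1.add h2).congr_deriv (by ring)
  have hb : ∀ t ∈ Icc (-|h|) |h|, ‖deriv f (x + t) - deriv f (x - t)‖ ≤ 2 * M * |h| := fun t ht => by
    have := hM.dist_le_mul (x + t) (x - t)
    rw [Real.dist_eq, Real.dist_eq, show x + t - (x - t) = 2 * t by ring, abs_mul, abs_two] at this
    rw [Real.norm_eq_abs]
    refine this.trans ?_
    have h1 : |t| ≤ |h| := abs_le.2 ht
    have h2 : (0 : ℝ) ≤ M := M.2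
    nlinarith
  have := (convex_Icc (-|h|) |h|).norm_image_sub_le_of_norm_hasDerivWithin_le
    (fun t _ => (hd t).hasDerivWithinAt) hb (x := 0) (y := h) (by simp)
    ⟨neg_abs_le h, le_abs_self h⟩
  simp only [add_zero, sub_zero, Real.norm_eq_abs] at this
  rw [show f (x + h) + f (x - h) - 2 * f x = f (x + h) + f (x - h) - (f x + f x) by ring]
  calc _ ≤ _ := this
    _ = 2 * M * |h| ^ 2 := by ring
    _ = _ := by rw [sq_abs]

/-- `χ` is a cutoff function, equal to `1` up to distance `η` from the endpoints `±2`, whose product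
with the arcsine density is regular. -/
structure IsCutoff (η : ℝ) (χ : ℝ → ℝ) (M : ℝ) : Prop where
  measurable : Measurable χ
  nonneg : ∀ x, 0 ≤ χ x
  le_one : ∀ x, χ x ≤ 1
  eq_one : ∀ x, |x| ≤ 2 - η → χ x = 1
  continuous_mul : Continuous fun x => χ x * arcsineDensity x
  mul_le : ∀ x, χ x * arcsineDensity x ≤ M
  second_difference_le : ∀ x h, |χ (x + h) * arcsineDensity (x + h)
    + χ (x - h) * arcsineDensity (x - h) - 2 * (χ x * arcsineDensity x)| ≤ M * h ^ 2

/-- A bump of radii `2 - η` and `2 - η/2` vanishes near the singularities `±2`, so its product with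
the density is `C²` with compact support; such a function is bounded with Lipschitz derivative. -/
theorem exists_isCutoff {η : ℝ} (h0 : 0 < η) (h1 : η ≤ 1) : ∃ χ M, IsCutoff η χ M := by
  let b : ContDiffBump (0 : ℝ) := ⟨2 - η, 2 - η / 2, by linarith, by linarith⟩
  have hsm : ContDiff ℝ 2 fun x => b x * arcsineDensity x := by
    rw [contDiff_iff_contDiffAt]
    intro x
    rcases lt_or_ge |x| 2 with hx | hx
    · have h4 : 0 < 4 - x ^ 2 := by
        have := abs_lt.1 hx
        nlinarith
      have h5 : ContDiffAt ℝ 2 (fun x : ℝ => √(4 - x ^ 2)) x :=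
        ContDiffAt.sqrt (by fun_prop) h4.ne'
      refine b.contDiffAt.mul ?_
      exact (contDiffAt_const.mul h5).inv (by positivity)
    · have : (fun x => b x * arcsineDensity x) =ᶠ[𝓝 x] fun _ => 0 := by
        have hl : 2 - η / 2 < |x| := by linarith
        filter_upwards [continuous_abs.continuousAt.eventually (lt_mem_nhds hl)] with y hy
        rw [b.zero_of_le_dist (by rw [Real.dist_eq, sub_zero]; exact hy.le), zero_mul]
      exact contDiffAt_const.congr_of_eventuallyEq this
  have hcs : HasCompactSupport fun x => b x * arcsineDensity x := b.hasCompactSupport.mul_right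
  obtain ⟨L, hL⟩ := (hsm.deriv' : ContDiff ℝ 1 _).lipschitzWith_of_hasCompactSupport hcs.deriv
    (by norm_num)
  obtain ⟨B, hB⟩ := hcs.exists_bound_of_continuous hsm.continuous
  refine ⟨b, max B (2 * L), b.continuous.measurable, fun x => b.nonneg, fun x => b.le_one,
    fun x hx => b.one_of_mem_closedBall ?_, hsm.continuous, fun x => ?_, fun x h => ?_⟩
  · rwa [mem_closedBall_zero_iff]
  · exact (le_abs_self _).trans ((hB x).trans (le_max_left _ _))
  · refine (abs_second_difference_le (hsm.differentiable (by norm_num)) hL x h).trans ?_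
    gcongr
    exact le_max_right _ _

/-- The density of `x + y + t z` near `0`, when `u` has been integrated out in a region where
its density is regular, conditionally on the remaining two variables `p`. -/
def localKernel (χ : ℝ → ℝ) (t e : ℝ) (p : ℝ × ℝ) : ℝ :=
  (2 - χ p.1) * (χ (e - (p.1 + t * p.2)) * arcsineDensity (e - (p.1 + t * p.2)))
    + (1 - χ p.1) * (1 - χ p.2) *
      (t⁻¹ * (χ (t⁻¹ * (e - (p.1 + p.2))) * arcsineDensity (t⁻¹ * (e - (p.1 + p.2)))))

/-- The density of states near `0`. -/
def localDensity (χ : ℝ → ℝ) (t e : ℝ) : ℝ :=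
  ∫ p, localKernel χ t e p ∂(arcsineLaw.prod arcsineLaw)

theorem lintegral_comp_affine {t : ℝ} (ht : 0 < t) (w : ℝ) (g : ℝ → ℝ≥0∞) :
    ∫⁻ u, g (w + t * u) = ∫⁻ e, ENNReal.ofReal t⁻¹ * g e := by
  have h := lintegral_image_eq_lintegral_abs_deriv_mul (s := univ) (f := fun u => w + t * u)
    (f' := fun _ => t) MeasurableSet.univ
    (fun x _ => ((((hasDerivAt_id x).const_mul t).const_add w).congr_deriv
      (mul_one t)).hasDerivWithinAt)
    (fun x _ y _ hxy => by simpa [ht.ne'] using hxy) (fun e => ENNReal.ofReal t⁻¹ * g e)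
  have himg : (fun u => w + t * u) '' univ = univ := by
    rw [image_univ, range_eq_univ]
    intro y
    exact ⟨(y - w) / t, by simp only; field_simp; ring⟩
  rw [himg, setLIntegral_univ, setLIntegral_univ] at h
  rw [h]
  refine lintegral_congr fun u => ?_
  rw [← mul_assoc, abs_of_pos ht, ← ENNReal.ofReal_mul ht.le, mul_inv_cancel₀ ht.ne',
    ENNReal.ofReal_one, one_mul]

theorem lintegral_cutoff_mul {η M t : ℝ} {χ : ℝ → ℝ} (hχ : IsCutoff η χ M) (ht : 0 < t) (w : ℝ)
    {f : ℝ → ℝ≥0∞} (hf : Measurable f) :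
    ∫⁻ u, ENNReal.ofReal (χ u) * f (w + t * u) ∂arcsineLaw
      = ∫⁻ e, f e * ENNReal.ofReal
        (t⁻¹ * (χ (t⁻¹ * (e - w)) * arcsineDensity (t⁻¹ * (e - w)))) := by
  have hm := hχ.measurable
  rw [lintegral_arcsineLaw (by fun_prop)]
  have h := lintegral_comp_affine ht w fun e =>
    f e * ENNReal.ofReal (χ (t⁻¹ * (e - w)) * arcsineDensity (t⁻¹ * (e - w)))
  calc _ = ∫⁻ u, f (w + t * u) * ENNReal.ofReal (χ (t⁻¹ * (w + t * u - w))
        * arcsineDensity (t⁻¹ * (w + t * u - w))) := by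
        refine lintegral_congr fun u => ?_
        have : t⁻¹ * (w + t * u - w) = u := by field_simp; ring
        rw [this, ENNReal.ofReal_mul (hχ.nonneg u)]
        ring
    _ = _ := h
    _ = _ := by
        refine lintegral_congr fun e => ?_
        rw [ENNReal.ofReal_mul (inv_nonneg.2 ht.le)]
        ring

theorem localKernel_nonneg {η M t : ℝ} {χ : ℝ → ℝ} (hχ : IsCutoff η χ M) (ht : 0 < t) (e : ℝ)
    (p : ℝ × ℝ) : 0 ≤ localKernel χ t e p := by
  have h1 := hχ.nonneg (e - (p.1 + t * p.2))
  have h2 := hχ.nonneg (t⁻¹ * (e - (p.1 + p.2)))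
  have h3 := arcsineDensity_nonneg (e - (p.1 + t * p.2))
  have h4 := arcsineDensity_nonneg (t⁻¹ * (e - (p.1 + p.2)))
  have h5 := sub_nonneg.2 (hχ.le_one p.1)
  have h6 := sub_nonneg.2 (hχ.le_one p.2)
  have h7 : 0 ≤ 2 - χ p.1 := by linarith
  unfold localKernel
  positivity

theorem measurable_localKernel {η M t : ℝ} {χ : ℝ → ℝ} (hχ : IsCutoff η χ M) :
    Measurable fun q : ℝ × ℝ × ℝ => localKernel χ t q.1 q.2 := by
  have h1 := hχ.measurable
  have h2 := measurable_arcsineDensity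
  unfold localKernel
  fun_prop

/-- If `x` and `y` have equal signs, the sum has modulus at least `4 - 2η - 2t`. If they have
opposite signs, `|x + y| ≤ η` and `t|z| ≥ 2t - 2η`, so the modulus is at least `2t - 3η`. -/
theorem abs_add_add_ge {η δ t x y z : ℝ} (h1 : δ + 3 * η ≤ 2 * t) (h2 : δ + 3 * η ≤ 4 - 2 * t)
    (hη : 0 < η) (ht : 0 < t) (ht2 : t < 2) (hx : 2 - η ≤ |x|) (hx2 : |x| ≤ 2) (hy : 2 - η ≤ |y|)
    (hy2 : |y| ≤ 2) (hz : 2 - η ≤ |z|) (hz2 : |z| ≤ 2) : δ ≤ |x + y + t * z| := by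
  have a1 : t * |z| ≤ t * 2 := by gcongr
  have a2 : t * (2 - η) ≤ t * |z| := by gcongr
  have a3 : t * η ≤ 2 * η := by gcongr
  have a4 : |t * z| = t * |z| := by rw [abs_mul, abs_of_pos ht]
  generalize t * z = s at *
  grind

theorem lintegral_lintegral_prod_left {F : ℝ → ℝ → ℝ → ℝ≥0∞}
    (hF : Measurable fun q : ℝ × ℝ × ℝ => F q.1 q.2.1 q.2.2) :
    ∫⁻ x, ∫⁻ y, ∫⁻ z, F x y z ∂arcsineLaw ∂arcsineLaw ∂arcsineLaw
      = ∫⁻ p, ∫⁻ u, F u p.1 p.2 ∂arcsineLaw ∂(arcsineLaw.prod arcsineLaw) := by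
  rw [← lintegral_prod_symm (μ := arcsineLaw) (ν := arcsineLaw.prod arcsineLaw) _ hF.aemeasurable,
    lintegral_prod _ hF.aemeasurable]
  refine lintegral_congr fun x => ?_
  rw [lintegral_prod (fun p : ℝ × ℝ => F x p.1 p.2)
    (hF.comp (measurable_const.prodMk measurable_id)).aemeasurable]

theorem lintegral_lintegral_prod_right {F : ℝ → ℝ → ℝ → ℝ≥0∞}
    (hF : Measurable fun q : ℝ × ℝ × ℝ => F q.1 q.2.1 q.2.2) :
    ∫⁻ x, ∫⁻ y, ∫⁻ z, F x y z ∂arcsineLaw ∂arcsineLaw ∂arcsineLaw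
      = ∫⁻ p, ∫⁻ u, F p.1 p.2 u ∂arcsineLaw ∂(arcsineLaw.prod arcsineLaw) := by
  rw [lintegral_prod]
  have : Measurable fun r : (ℝ × ℝ) × ℝ => F r.1.1 r.1.2 r.2 :=
    hF.comp (measurable_fst.fst.prodMk (measurable_fst.snd.prodMk measurable_snd))
  exact this.lintegral_prod_right'.aemeasurable

theorem lintegral_lintegral_prod_mid {F : ℝ → ℝ → ℝ → ℝ≥0∞}
    (hF : Measurable fun q : ℝ × ℝ × ℝ => F q.1 q.2.1 q.2.2) :
    ∫⁻ x, ∫⁻ y, ∫⁻ z, F x y z ∂arcsineLaw ∂arcsineLaw ∂arcsineLaw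
      = ∫⁻ p, ∫⁻ u, F p.1 u p.2 ∂arcsineLaw ∂(arcsineLaw.prod arcsineLaw) := by
  have h : Measurable fun q : ℝ × ℝ × ℝ => F q.1 q.2.2 q.2.1 :=
    hF.comp (measurable_fst.prodMk (measurable_snd.snd.prodMk measurable_snd.fst))
  rw [← lintegral_lintegral_prod_right (F := fun x z y => F x y z) h]
  refine lintegral_congr fun x => ?_
  exact lintegral_lintegral_swap
    (hF.comp (measurable_const.prodMk measurable_id)).aemeasurable

theorem lintegral_bandLaw_eq_localDensity {η δ M tz : ℝ} {χ : ℝ → ℝ} (hχ : IsCutoff η χ M)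
    (hη : 0 < η) (h1 : δ + 3 * η ≤ 2 * tz) (h2 : δ + 3 * η ≤ 4 - 2 * tz) (h0 : 0 < tz)
    (htz2 : tz < 2) {f : ℝ → ℝ≥0∞} (hf : Measurable f) (hfδ : ∀ e, δ ≤ |e| → f e = 0) :
    ∫⁻ e, f e ∂bandLaw tz
      = ∫⁻ e, ∫⁻ p, f e * ENNReal.ofReal (localKernel χ tz e p)
          ∂(arcsineLaw.prod arcsineLaw) := by
  have hm := hχ.measurable
  let c : ℝ → ℝ≥0∞ := fun u => ENNReal.ofReal (χ u)
  let d : ℝ → ℝ≥0∞ := fun u => ENNReal.ofReal (1 - χ u)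
  have hc : Measurable c := hm.ennreal_ofReal
  have hd : Measurable d := (measurable_const.sub hm).ennreal_ofReal
  have hcd : ∀ u, c u + d u = 1 := fun u => by
    rw [← ENNReal.ofReal_add (hχ.nonneg u) (sub_nonneg.2 (hχ.le_one u))]
    simp
  have hd0 : ∀ u, |u| ≤ 2 - η → d u = 0 := fun u hu => by simp [d, hχ.eq_one u hu]
  let s : ℝ → ℝ → ℝ → ℝ := fun x y z => x + y + tz * z
  have hs : Measurable fun q : ℝ × ℝ × ℝ => f (s q.1 q.2.1 q.2.2) := by
    simp only [s]; fun_prop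
  -- With `d = 1 - c`, the partition is `1 = c(x) + d(x)c(y) + d(x)d(y)c(z) + d(x)d(y)d(z)`. The
  -- last term lives near the corners, where the energy has modulus at least `δ` and `f` vanishes.
  have hsplit : ∀ x y z, |x| ≤ 2 → |y| ≤ 2 → |z| ≤ 2 → f (s x y z)
      = c x * f (s x y z) + (d x * (c y * f (s x y z)) + d x * d y * (c z * f (s x y z))) := by
    intro x y z hx hy hz
    have hzero : d x * d y * (d z * f (s x y z)) = 0 := by
      by_cases hx' : |x| ≤ 2 - η
      · simp [hd0 x hx']
      by_cases hy' : |y| ≤ 2 - η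
      · simp [hd0 y hy']
      by_cases hz' : |z| ≤ 2 - η
      · simp [hd0 z hz']
      rw [hfδ _ (abs_add_add_ge h1 h2 hη h0 htz2 (not_le.1 hx').le hx (not_le.1 hy').le hy
        (not_le.1 hz').le hz)]
      simp
    calc f (s x y z) = c x * f (s x y z) + d x * f (s x y z) := by rw [← add_mul, hcd, one_mul]
      _ = c x * f (s x y z) + (d x * (c y * f (s x y z)) + d x * d y * f (s x y z)) := by
        congr 1
        rw [mul_assoc (d x) (d y), ← mul_add, ← add_mul, hcd, one_mul]
      _ = c x * f (s x y z) + (d x * (c y * f (s x y z)) + (d x * d y * (c z * f (s x y z))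
            + d x * d y * (d z * f (s x y z)))) := by
        rw [← mul_add, ← add_mul, hcd, one_mul]
      _ = _ := by rw [hzero, add_zero]
  have m1 : Measurable fun q : ℝ × ℝ × ℝ => c q.1 * f (s q.1 q.2.1 q.2.2) := by fun_prop
  have m2 : Measurable fun q : ℝ × ℝ × ℝ => d q.1 * (c q.2.1 * f (s q.1 q.2.1 q.2.2)) := by
    fun_prop
  have m3 : Measurable fun q : ℝ × ℝ × ℝ =>
      d q.1 * d q.2.1 * (c q.2.2 * f (s q.1 q.2.1 q.2.2)) := by fun_prop
  have m123 : Measurable fun q : ℝ × ℝ × ℝ => c q.1 * f (s q.1 q.2.1 q.2.2)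
      + (d q.1 * (c q.2.1 * f (s q.1 q.2.1 q.2.2))
        + d q.1 * d q.2.1 * (c q.2.2 * f (s q.1 q.2.1 q.2.2))) := m1.add (m2.add m3)
  have hprod : ∀ {F : ℝ → ℝ → ℝ → ℝ≥0∞}, Measurable (fun q : ℝ × ℝ × ℝ => F q.1 q.2.1 q.2.2) →
      ∫⁻ q, F q.1 q.2.1 q.2.2 ∂(arcsineLaw.prod (arcsineLaw.prod arcsineLaw))
      = ∫⁻ x, ∫⁻ y, ∫⁻ z, F x y z ∂arcsineLaw ∂arcsineLaw ∂arcsineLaw := fun {F} hF => by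
    rw [lintegral_prod _ hF.aemeasurable]
    refine lintegral_congr fun x => ?_
    exact lintegral_prod _ (hF.comp (measurable_const.prodMk measurable_id)).aemeasurable
  have e0 : ∫⁻ e, f e ∂bandLaw tz
      = ∫⁻ q, (c q.1 * f (s q.1 q.2.1 q.2.2) + (d q.1 * (c q.2.1 * f (s q.1 q.2.1 q.2.2))
        + d q.1 * d q.2.1 * (c q.2.2 * f (s q.1 q.2.1 q.2.2))))
        ∂(arcsineLaw.prod (arcsineLaw.prod arcsineLaw)) := by
    rw [lintegral_bandLaw tz hf, hprod (F := fun x y z => c x * f (s x y z)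
      + (d x * (c y * f (s x y z)) + d x * d y * (c z * f (s x y z)))) m123]
    refine lintegral_congr_ae (ae_arcsineLaw_abs_le.mono fun x hx => ?_)
    refine lintegral_congr_ae (ae_arcsineLaw_abs_le.mono fun y hy => ?_)
    refine lintegral_congr_ae (ae_arcsineLaw_abs_le.mono fun z hz => ?_)
    exact hsplit x y z hx hy hz
  have k1 : ∀ p : ℝ × ℝ, ∫⁻ u, c u * f (s u p.1 p.2) ∂arcsineLaw
      = ∫⁻ e, f e * ENNReal.ofReal
        (χ (e - (p.1 + tz * p.2)) * arcsineDensity (e - (p.1 + tz * p.2))) := fun p => by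
    have := lintegral_cutoff_mul hχ one_pos (p.1 + tz * p.2) hf
    simp only [inv_one, one_mul] at this
    rw [← this]
    refine lintegral_congr fun u => ?_
    congr 2
    simp only [s]
    ring
  have k2 : ∀ p : ℝ × ℝ, ∫⁻ u, d p.1 * (c u * f (s p.1 u p.2)) ∂arcsineLaw
      = ∫⁻ e, d p.1 * (f e * ENNReal.ofReal
        (χ (e - (p.1 + tz * p.2)) * arcsineDensity (e - (p.1 + tz * p.2)))) := fun p => by
    rw [lintegral_const_mul' _ _ ENNReal.ofReal_ne_top,
      lintegral_const_mul' _ _ ENNReal.ofReal_ne_top, ← k1]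
    congr 1
    refine lintegral_congr fun u => ?_
    congr 2
    simp only [s]
    ring
  have k3 : ∀ p : ℝ × ℝ, ∫⁻ u, d p.1 * d p.2 * (c u * f (s p.1 p.2 u)) ∂arcsineLaw
      = ∫⁻ e, d p.1 * d p.2 * (f e * ENNReal.ofReal (tz⁻¹ * (χ (tz⁻¹ * (e - (p.1 + p.2)))
        * arcsineDensity (tz⁻¹ * (e - (p.1 + p.2)))))) := fun p => by
    have hne : d p.1 * d p.2 ≠ ∞ := ENNReal.mul_ne_top ENNReal.ofReal_ne_top ENNReal.ofReal_ne_top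
    rw [lintegral_const_mul' _ _ hne, lintegral_const_mul' _ _ hne,
      ← lintegral_cutoff_mul hχ h0 (p.1 + p.2) hf]
  have hα := measurable_arcsineDensity
  have hK := (measurable_localKernel (t := tz) hχ).ennreal_ofReal
  rw [e0, lintegral_add_left m1, lintegral_add_left m2,
    hprod (F := fun x y z => c x * f (s x y z)) m1,
    hprod (F := fun x y z => d x * (c y * f (s x y z))) m2,
    hprod (F := fun x y z => d x * d y * (c z * f (s x y z))) m3,
    lintegral_lintegral_prod_left (F := fun x y z => c x * f (s x y z)) m1,
    lintegral_lintegral_prod_mid (F := fun x y z => d x * (c y * f (s x y z))) m2,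
    lintegral_lintegral_prod_right (F := fun x y z => d x * d y * (c z * f (s x y z))) m3]
  simp only [k1, k2, k3]
  rw [lintegral_lintegral_swap (f := fun e p => f e * ENNReal.ofReal (localKernel χ tz e p))
    ((hf.comp measurable_fst).mul hK).aemeasurable, ← lintegral_add_left (by fun_prop),
    ← lintegral_add_left (by fun_prop)]
  refine lintegral_congr fun p => ?_
  rw [← lintegral_add_left (by fun_prop), ← lintegral_add_left (by fun_prop)]
  refine lintegral_congr fun e => ?_
  have p1 := sub_nonneg.2 (hχ.le_one p.1)
  have p2 := sub_nonneg.2 (hχ.le_one p.2)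
  -- The weight `2 - χ` is `1 + (1 - χ)`: integrating out `x` and integrating out `y` produce the
  -- same density factor, `p.1` being the other of the two variables.
  have hk : localKernel χ tz e p = χ (e - (p.1 + tz * p.2)) * arcsineDensity (e - (p.1 + tz * p.2))
      + ((1 - χ p.1) * (χ (e - (p.1 + tz * p.2)) * arcsineDensity (e - (p.1 + tz * p.2)))
      + (1 - χ p.1) * (1 - χ p.2) * (tz⁻¹ * (χ (tz⁻¹ * (e - (p.1 + p.2)))
        * arcsineDensity (tz⁻¹ * (e - (p.1 + p.2)))))) := by
    rw [localKernel]
    ring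
  have hA0 : 0 ≤ χ (e - (p.1 + tz * p.2)) * arcsineDensity (e - (p.1 + tz * p.2)) :=
    mul_nonneg (hχ.nonneg _) (arcsineDensity_nonneg _)
  have hB0 : 0 ≤ tz⁻¹ * (χ (tz⁻¹ * (e - (p.1 + p.2)))
      * arcsineDensity (tz⁻¹ * (e - (p.1 + p.2)))) :=
    mul_nonneg (inv_nonneg.2 h0.le) (mul_nonneg (hχ.nonneg _) (arcsineDensity_nonneg _))
  rw [hk]
  generalize χ (e - (p.1 + tz * p.2)) * arcsineDensity (e - (p.1 + tz * p.2)) = A at *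
  generalize tz⁻¹ * (χ (tz⁻¹ * (e - (p.1 + p.2)))
      * arcsineDensity (tz⁻¹ * (e - (p.1 + p.2)))) = B at *
  rw [ENNReal.ofReal_add hA0 (add_nonneg (mul_nonneg p1 hA0) (mul_nonneg (mul_nonneg p1 p2) hB0)),
    ENNReal.ofReal_add (mul_nonneg p1 hA0) (mul_nonneg (mul_nonneg p1 p2) hB0),
    ENNReal.ofReal_mul p1, ENNReal.ofReal_mul (mul_nonneg p1 p2), ENNReal.ofReal_mul p1]
  simp only [d]
  ring

/-! ### Bounds for the local density and its identification with `N`. -/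

section LocalDensity

variable {η M t : ℝ} {χ : ℝ → ℝ}

theorem IsCutoff.bound_nonneg (hχ : IsCutoff η χ M) : 0 ≤ M :=
  (mul_nonneg (hχ.nonneg 0) (arcsineDensity_nonneg 0)).trans (hχ.mul_le 0)

theorem continuous_localKernel (hχ : IsCutoff η χ M) (t : ℝ) (p : ℝ × ℝ) :
    Continuous fun e => localKernel χ t e p := by
  unfold localKernel
  refine (continuous_const.mul (hχ.continuous_mul.comp (by fun_prop))).add
    (continuous_const.mul (continuous_const.mul ?_))
  exact hχ.continuous_mul.comp (g := fun x => χ x * arcsineDensity x)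
    (f := fun e => t⁻¹ * (e - (p.1 + p.2))) (by fun_prop)

theorem localKernel_le (hχ : IsCutoff η χ M) (ht : 0 < t) (e : ℝ) (p : ℝ × ℝ) :
    localKernel χ t e p ≤ M * (2 + t⁻¹) := by
  have h1 := hχ.mul_le (e - (p.1 + t * p.2))
  have h2 := hχ.mul_le (t⁻¹ * (e - (p.1 + p.2)))
  have h5 := sub_nonneg.2 (hχ.le_one p.1)
  have h6 := sub_nonneg.2 (hχ.le_one p.2)
  have h7 := hχ.nonneg p.1
  have h8 := hχ.nonneg p.2
  have hM := hχ.bound_nonneg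
  unfold localKernel
  have e1 : (2 - χ p.1) * (χ (e - (p.1 + t * p.2)) * arcsineDensity (e - (p.1 + t * p.2)))
      ≤ 2 * M := mul_le_mul (by linarith) h1
        (mul_nonneg (hχ.nonneg _) (arcsineDensity_nonneg _)) (by norm_num)
  have e2 : (1 - χ p.1) * (1 - χ p.2) * (t⁻¹ * (χ (t⁻¹ * (e - (p.1 + p.2)))
      * arcsineDensity (t⁻¹ * (e - (p.1 + p.2))))) ≤ 1 * (t⁻¹ * M) :=
    mul_le_mul (mul_le_one₀ (by linarith) h6 (by linarith)) (by gcongr)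
      (mul_nonneg (inv_nonneg.2 ht.le) (mul_nonneg (hχ.nonneg _) (arcsineDensity_nonneg _)))
      zero_le_one
  linarith

/-- In `t⁻¹ ^ 3`, one factor is the Jacobian and two come from the rescaled increment `t⁻¹ * e`. -/
theorem abs_localKernel_second_difference_le (hχ : IsCutoff η χ M) (ht : 0 < t) (e : ℝ)
    (p : ℝ × ℝ) :
    |localKernel χ t e p + localKernel χ t (-e) p - 2 * localKernel χ t 0 p|
      ≤ M * (2 + t⁻¹ ^ 3) * e ^ 2 := by
  have h1 := hχ.second_difference_le (0 - (p.1 + t * p.2)) e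
  have h2 := hχ.second_difference_le (t⁻¹ * (0 - (p.1 + p.2))) (t⁻¹ * e)
  have h5 := sub_nonneg.2 (hχ.le_one p.1)
  have h6 := sub_nonneg.2 (hχ.le_one p.2)
  have h7 := hχ.nonneg p.1
  have h8 := hχ.nonneg p.2
  have hM := hχ.bound_nonneg
  have a1 : e - (p.1 + t * p.2) = 0 - (p.1 + t * p.2) + e := by ring
  have a2 : -e - (p.1 + t * p.2) = 0 - (p.1 + t * p.2) - e := by ring
  have a3 : t⁻¹ * (e - (p.1 + p.2)) = t⁻¹ * (0 - (p.1 + p.2)) + t⁻¹ * e := by ring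
  have a4 : t⁻¹ * (-e - (p.1 + p.2)) = t⁻¹ * (0 - (p.1 + p.2)) - t⁻¹ * e := by ring
  unfold localKernel
  rw [a1, a2, a3, a4]
  set A := χ (0 - (p.1 + t * p.2) + e) * arcsineDensity (0 - (p.1 + t * p.2) + e)
  set A' := χ (0 - (p.1 + t * p.2) - e) * arcsineDensity (0 - (p.1 + t * p.2) - e)
  set A₀ := χ (0 - (p.1 + t * p.2)) * arcsineDensity (0 - (p.1 + t * p.2))
  set B := χ (t⁻¹ * (0 - (p.1 + p.2)) + t⁻¹ * e)
    * arcsineDensity (t⁻¹ * (0 - (p.1 + p.2)) + t⁻¹ * e)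
  set B' := χ (t⁻¹ * (0 - (p.1 + p.2)) - t⁻¹ * e)
    * arcsineDensity (t⁻¹ * (0 - (p.1 + p.2)) - t⁻¹ * e)
  set B₀ := χ (t⁻¹ * (0 - (p.1 + p.2))) * arcsineDensity (t⁻¹ * (0 - (p.1 + p.2)))
  have e0 : (2 - χ p.1) * A + (1 - χ p.1) * (1 - χ p.2) * (t⁻¹ * B)
      + ((2 - χ p.1) * A' + (1 - χ p.1) * (1 - χ p.2) * (t⁻¹ * B'))
      - 2 * ((2 - χ p.1) * A₀ + (1 - χ p.1) * (1 - χ p.2) * (t⁻¹ * B₀))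
      = (2 - χ p.1) * (A + A' - 2 * A₀)
        + (1 - χ p.1) * (1 - χ p.2) * (t⁻¹ * (B + B' - 2 * B₀)) := by ring
  rw [e0]
  have e1 : |(2 - χ p.1) * (A + A' - 2 * A₀)| ≤ 2 * (M * e ^ 2) := by
    rw [abs_mul, abs_of_nonneg (by linarith : 0 ≤ 2 - χ p.1)]
    exact mul_le_mul (by linarith) h1 (abs_nonneg _) (by norm_num)
  have e2 : |(1 - χ p.1) * (1 - χ p.2) * (t⁻¹ * (B + B' - 2 * B₀))|
      ≤ 1 * (t⁻¹ * (M * (t⁻¹ * e) ^ 2)) := by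
    rw [abs_mul, abs_mul, abs_mul, abs_of_nonneg h5, abs_of_nonneg h6, abs_of_pos (inv_pos.2 ht)]
    exact mul_le_mul (mul_le_one₀ (by linarith) h6 (by linarith)) (by gcongr) (by positivity)
      zero_le_one
  calc _ ≤ _ := abs_add_le _ _
    _ ≤ 2 * (M * e ^ 2) + 1 * (t⁻¹ * (M * (t⁻¹ * e) ^ 2)) := add_le_add e1 e2
    _ = _ := by ring

theorem aestronglyMeasurable_localKernel (hχ : IsCutoff η χ M) (t e : ℝ) :
    AEStronglyMeasurable (localKernel χ t e) (arcsineLaw.prod arcsineLaw) :=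
  ((measurable_localKernel hχ).comp (measurable_const.prodMk measurable_id)).aestronglyMeasurable

theorem norm_localKernel_le (hχ : IsCutoff η χ M) (ht : 0 < t) (e : ℝ) (p : ℝ × ℝ) :
    ‖localKernel χ t e p‖ ≤ M * (2 + t⁻¹) := by
  rw [Real.norm_of_nonneg (localKernel_nonneg hχ ht e p)]
  exact localKernel_le hχ ht e p

theorem integrable_localKernel (hχ : IsCutoff η χ M) (ht : 0 < t) (e : ℝ) :
    Integrable (localKernel χ t e) (arcsineLaw.prod arcsineLaw) :=
  Integrable.of_bound (aestronglyMeasurable_localKernel hχ t e) _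
    (ae_of_all _ (norm_localKernel_le hχ ht e))

theorem continuous_localDensity (hχ : IsCutoff η χ M) (ht : 0 < t) :
    Continuous (localDensity χ t) :=
  continuous_of_dominated (aestronglyMeasurable_localKernel hχ t)
    (fun e => ae_of_all _ (norm_localKernel_le hχ ht e)) (integrable_const _)
    (ae_of_all _ (continuous_localKernel hχ t))

theorem localDensity_nonneg (hχ : IsCutoff η χ M) (ht : 0 < t) (e : ℝ) :
    0 ≤ localDensity χ t e :=
  integral_nonneg (localKernel_nonneg hχ ht e)

theorem localDensity_le (hχ : IsCutoff η χ M) (ht : 0 < t) (e : ℝ) :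
    localDensity χ t e ≤ M * (2 + t⁻¹) := by
  have := integral_mono (integrable_localKernel hχ ht e) (integrable_const _)
    (localKernel_le hχ ht e)
  simpa [localDensity] using this

theorem abs_localDensity_second_difference_le (hχ : IsCutoff η χ M) (ht : 0 < t) (e : ℝ) :
    |localDensity χ t e + localDensity χ t (-e) - 2 * localDensity χ t 0|
      ≤ M * (2 + t⁻¹ ^ 3) * e ^ 2 := by
  have i1 := integrable_localKernel hχ ht e
  have i2 := integrable_localKernel hχ ht (-e)
  have i3 := integrable_localKernel hχ ht 0
  unfold localDensity
  have i12 : Integrable (fun p => localKernel χ t e p + localKernel χ t (-e) p)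
    (arcsineLaw.prod arcsineLaw) := i1.add i2
  rw [← integral_const_mul, ← integral_add i1 i2, ← integral_sub i12 (i3.const_mul 2),
    ← Real.norm_eq_abs]
  have := norm_integral_le_of_norm_le_const (μ := arcsineLaw.prod arcsineLaw)
    (f := fun p => localKernel χ t e p + localKernel χ t (-e) p - 2 * localKernel χ t 0 p)
    (ae_of_all _ (abs_localKernel_second_difference_le hχ ht e))
  simpa using this

theorem le_arcsineDensity {x : ℝ} (hx : |x| ≤ 1) : (2 * π)⁻¹ ≤ arcsineDensity x := by
  have h1 : x ^ 2 ≤ 1 := by rw [← sq_abs]; exact pow_le_one₀ (abs_nonneg x) hx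
  have h2 : √(4 - x ^ 2) ≤ 2 := Real.sqrt_le_iff.2 ⟨by norm_num, by nlinarith⟩
  have h3 : 0 < √(4 - x ^ 2) := Real.sqrt_pos.2 (by linarith)
  have := Real.pi_pos
  unfold arcsineDensity
  gcongr ?_⁻¹
  nlinarith

/-- On the square of half-side `1/3` the argument of the density stays in `[-1, 1]`, where `χ = 1`,
and the weight `2 - χ` is at least `1`. Elsewhere the kernel is nonnegative. -/
theorem le_localDensity_zero (hχ : IsCutoff η χ M) (hη : η ≤ 1) (ht : 0 < t) (ht2 : t < 2) :
    (2 * π)⁻¹ * arcsineLaw.real (Icc (-(1 / 3)) (1 / 3)) ^ 2 ≤ localDensity χ t 0 := by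
  set S : Set (ℝ × ℝ) := Icc (-(1 / 3)) (1 / 3) ×ˢ Icc (-(1 / 3)) (1 / 3) with hSdef
  have hS : MeasurableSet S := measurableSet_Icc.prod measurableSet_Icc
  have h1 : (2 * π)⁻¹ * arcsineLaw.real (Icc (-(1 / 3)) (1 / 3)) ^ 2
      = ∫ p, S.indicator (fun _ => (2 * π)⁻¹) p ∂(arcsineLaw.prod arcsineLaw) := by
    rw [integral_indicator_const _ hS, hSdef, measureReal_prod_prod, smul_eq_mul]
    ring
  rw [h1]
  refine integral_mono ((integrable_const _).indicator hS) (integrable_localKernel hχ ht 0)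
    fun p => ?_
  by_cases hp : p ∈ S
  · rw [indicator_of_mem hp]
    have hp1 : |p.1| ≤ 1 / 3 := abs_le.2 hp.1
    have hp2 : |p.2| ≤ 1 / 3 := abs_le.2 hp.2
    have hx : |0 - (p.1 + t * p.2)| ≤ 1 := by
      rw [zero_sub, abs_neg]
      refine (abs_add_le _ _).trans ?_
      rw [abs_mul, abs_of_pos ht]
      nlinarith [abs_nonneg p.2]
    have h2 := le_arcsineDensity hx
    have h3 := sub_nonneg.2 (hχ.le_one p.1)
    have h4 := sub_nonneg.2 (hχ.le_one p.2)
    have h5 : 0 ≤ (1 - χ p.1) * (1 - χ p.2) * (t⁻¹ * (χ (t⁻¹ * (0 - (p.1 + p.2)))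
        * arcsineDensity (t⁻¹ * (0 - (p.1 + p.2))))) :=
      mul_nonneg (mul_nonneg h3 h4) (mul_nonneg (inv_nonneg.2 ht.le)
        (mul_nonneg (hχ.nonneg _) (arcsineDensity_nonneg _)))
    unfold localKernel
    rw [hχ.eq_one _ (hx.trans (by linarith)), one_mul]
    have h6 : 0 < (2 * π)⁻¹ := by positivity
    nlinarith
  · rw [indicator_of_notMem hp]
    exact localKernel_nonneg hχ ht 0 p

variable {δ : ℝ}

theorem bandLaw_real_Ioc (hχ : IsCutoff η χ M) (hη : 0 < η) (h1 : δ + 3 * η ≤ 2 * t)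
    (h2 : δ + 3 * η ≤ 4 - 2 * t) (h0 : 0 < t) (ht2 : t < 2) {a b : ℝ} (ha : -δ < a)
    (hb : b < δ) (hab : a ≤ b) :
    (bandLaw t).real (Ioc a b) = ∫ e in a..b, localDensity χ t e := by
  have hi : Measurable ((Ioc a b).indicator (1 : ℝ → ℝ≥0∞)) :=
    measurable_one.indicator measurableSet_Ioc
  have hz : ∀ e, δ ≤ |e| → (Ioc a b).indicator (1 : ℝ → ℝ≥0∞) e = 0 := fun e he => by
    refine indicator_of_notMem (fun hmem => ?_) _
    have : |e| < δ := abs_lt.2 ⟨ha.trans hmem.1, hmem.2.trans_lt hb⟩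
    linarith
  have h := lintegral_bandLaw_eq_localDensity hχ hη h1 h2 h0 ht2 hi hz
  rw [lintegral_indicator_one measurableSet_Ioc] at h
  have h3 : ∀ e, ∫⁻ p, (Ioc a b).indicator (1 : ℝ → ℝ≥0∞) e * ENNReal.ofReal (localKernel χ t e p)
      ∂(arcsineLaw.prod arcsineLaw)
      = (Ioc a b).indicator (fun e => ENNReal.ofReal (localDensity χ t e)) e := fun e => by
    rw [lintegral_const_mul' _ _ (by
      by_cases he : e ∈ Ioc a b <;> simp [he]), ← ofReal_integral_eq_lintegral_ofReal
        (integrable_localKernel hχ h0 e) (ae_of_all _ (localKernel_nonneg hχ h0 e))]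
    by_cases he : e ∈ Ioc a b <;> simp [he, localDensity]
  rw [lintegral_congr h3, lintegral_indicator measurableSet_Ioc] at h
  rw [measureReal_def, h, intervalIntegral.integral_of_le hab,
    integral_eq_lintegral_of_nonneg_ae (ae_of_all _ (localDensity_nonneg hχ h0))
      (continuous_localDensity hχ h0).aestronglyMeasurable]

/-- The local density is continuous, so the fundamental theorem of calculus gives equality at every
point near `0`, in particular at `0` itself, not merely almost everywhere. -/
theorem densityOfStates_eq_localDensity (hχ : IsCutoff η χ M) (hη : 0 < η)
    (h1 : δ + 3 * η ≤ 2 * t) (h2 : δ + 3 * η ≤ 4 - 2 * t) (h0 : 0 < t) (ht2 : t < 2) {e : ℝ}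
    (he : |e| < δ) : densityOfStates t e = localDensity χ t e := by
  obtain ⟨r, hr1, hr2⟩ := exists_between he
  have hc := continuous_localDensity hχ h0
  have hev : integratedDensity t =ᶠ[𝓝 e] fun x =>
      integratedDensity t (-r) + ∫ y in (-r)..x, localDensity χ t y := by
    filter_upwards [continuous_abs.continuousAt.eventually (gt_mem_nhds hr1)] with x hx
    have hx' := abs_lt.1 hx
    rw [← bandLaw_real_Ioc hχ hη h1 h2 h0 ht2 (by linarith) (by linarith) hx'.1.le,
      integratedDensity_eq, integratedDensity_eq,
      ← measureReal_union (Iic_disjoint_Ioc le_rfl) measurableSet_Ioc, Iic_union_Ioc_eq_Iic hx'.1.le]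
  rw [densityOfStates, hev.deriv_eq, deriv_const_add]
  exact (intervalIntegral.integral_hasDerivAt_right (hc.intervalIntegrable _ _)
    hc.stronglyMeasurable.stronglyMeasurableAtFilter hc.continuousAt).deriv

end LocalDensity

/-- Regularity of the density of states at `0`, uniformly for `tz` in `[a, b]`. -/
theorem exists_densityOfStates_bounds {a b : ℝ} (ha : 0 < a) (hb : b < 2) :
    ∃ δ B c : ℝ, 0 < δ ∧ δ ≤ 1 ∧ 0 < c ∧ 0 ≤ B ∧ ∀ tz ∈ Icc a b,
      c ≤ densityOfStates tz 0 ∧ densityOfStates tz 0 ≤ B ∧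
        ∀ e, |e| < δ → |densityOfStates tz e - densityOfStates tz 0| ≤ B * e ^ 2 := by
  -- With `δ = m/2` and `η = m/6`, `δ + 3η = m` is at most `2 tz` and `4 - 2 tz` for every `tz` in
  -- `[a, b]`, so a single cutoff serves them all.
  set m := min 1 (min (2 * a) (4 - 2 * b)) with hm
  have hm0 : 0 < m := lt_min one_pos (lt_min (by linarith) (by linarith))
  have hm1 : m ≤ 1 := min_le_left _ _
  have hm2 : m ≤ 2 * a := (min_le_right _ _).trans (min_le_left _ _)
  have hm3 : m ≤ 4 - 2 * b := (min_le_right _ _).trans (min_le_right _ _)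
  obtain ⟨χ, M, hχ⟩ := exists_isCutoff (η := m / 6) (by linarith) (by linarith)
  have hM := hχ.bound_nonneg
  refine ⟨m / 2, M * (2 + a⁻¹) + M * (2 + a⁻¹ ^ 3),
    (2 * π)⁻¹ * arcsineLaw.real (Icc (-(1 / 3)) (1 / 3)) ^ 2, by linarith, by linarith,
    mul_pos (by positivity) (pow_pos arcsineLaw_real_Icc_pos 2), by positivity, fun tz htz => ?_⟩
  have h0 : 0 < tz := ha.trans_le htz.1
  have h2 : tz < 2 := htz.2.trans_lt hb
  have heq : ∀ e, |e| < m / 2 → densityOfStates tz e = localDensity χ tz e := fun e he =>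
    densityOfStates_eq_localDensity hχ (by linarith) (by linarith [htz.1]) (by linarith [htz.2])
      h0 h2 he
  have hinv : tz⁻¹ ≤ a⁻¹ := inv_anti₀ ha htz.1
  have hinv0 : 0 < tz⁻¹ := inv_pos.2 h0
  have hz := heq 0 (by rw [abs_zero]; linarith)
  refine ⟨?_, ?_, fun e he => ?_⟩
  · rw [hz]
    exact le_localDensity_zero hχ (by linarith) h0 h2
  · rw [hz]
    refine (localDensity_le hχ h0 0).trans ?_
    have : M * (2 + tz⁻¹) ≤ M * (2 + a⁻¹) := by gcongr
    have : 0 ≤ M * (2 + a⁻¹ ^ 3) := by positivity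
    linarith
  · have h := abs_localDensity_second_difference_le hχ h0 e
    -- Evenness makes the second difference at `0` equal to `2 (N(e) - N(0))`.
    rw [← heq e he, ← heq (-e) (by rwa [abs_neg]), ← hz, densityOfStates_neg,
      show ∀ x y : ℝ, x + x - 2 * y = 2 * (x - y) from fun x y => by ring, abs_mul, abs_two] at h
    have h3 : M * (2 + tz⁻¹ ^ 3) * e ^ 2 ≤ M * (2 + a⁻¹ ^ 3) * e ^ 2 := by gcongr
    have h4 : 0 ≤ M * (2 + a⁻¹) * e ^ 2 := by positivity
    have := abs_nonneg (densityOfStates tz e - densityOfStates tz 0)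
    rw [add_mul]
    linarith

/-! ### The gap integral: bounds, monotonicity, continuity. -/

/-- The right-hand side of the equation for the Néel temperature, divided by `U`. -/
def gapIntegral (tz T : ℝ) : ℝ := ∫ e, tanh (e / (2 * T)) / (2 * e) ∂bandLaw tz

theorem tanh_div_two_mul (T e : ℝ) :
    tanh (e / (2 * T)) / (2 * e) = (4 * T)⁻¹ * (tanh (e / (2 * T)) / (e / (2 * T))) := by
  rcases eq_or_ne T 0 with rfl | hT
  · simp
  · field_simp
    ring

theorem measurable_gapIntegrand (T : ℝ) :
    Measurable fun e : ℝ => tanh (e / (2 * T)) / (2 * e) :=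
  (continuous_tanh.measurable.comp (measurable_id.div_const _)).div (measurable_const_mul 2)

theorem gapIntegrand_nonneg {T : ℝ} (hT : 0 < T) (e : ℝ) : 0 ≤ tanh (e / (2 * T)) / (2 * e) := by
  rw [tanh_div_two_mul]
  exact mul_nonneg (by positivity) (tanh_div_nonneg _)

theorem gapIntegrand_le {T : ℝ} (hT : 0 < T) (e : ℝ) :
    tanh (e / (2 * T)) / (2 * e) ≤ (4 * T)⁻¹ := by
  rw [tanh_div_two_mul]
  exact mul_le_of_le_one_right (by positivity) (tanh_div_le_one _)

theorem norm_gapIntegrand_le {T : ℝ} (hT : 0 < T) (e : ℝ) :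
    ‖tanh (e / (2 * T)) / (2 * e)‖ ≤ (4 * T)⁻¹ := by
  rw [Real.norm_of_nonneg (gapIntegrand_nonneg hT e)]
  exact gapIntegrand_le hT e

theorem integrable_gapIntegrand (tz : ℝ) {T : ℝ} (hT : 0 < T) :
    Integrable (fun e => tanh (e / (2 * T)) / (2 * e)) (bandLaw tz) :=
  Integrable.of_bound (measurable_gapIntegrand T).aestronglyMeasurable _
    (ae_of_all _ (norm_gapIntegrand_le hT))

/-- Source of the a priori bound `T ≤ U / 4` and of the upper endpoint in the existence argument. -/
theorem gapIntegral_le (tz : ℝ) {T : ℝ} (hT : 0 < T) : gapIntegral tz T ≤ (4 * T)⁻¹ := by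
  have := integral_mono (integrable_gapIntegrand tz hT) (integrable_const _) (gapIntegrand_le hT)
  simpa [gapIntegral] using this

theorem isNeelTemperature_iff {U tz T : ℝ} :
    IsNeelTemperature U tz T ↔ 0 < T ∧ 1 = U * gapIntegral tz T := by
  have h := setIntegral_momentumCube_band tz (g := fun e => U * tanh (e / (2 * T)) / (2 * e)) (by
    simpa only [mul_div_assoc] using (measurable_gapIntegrand T).const_mul U)
  rw [IsNeelTemperature, h, gapIntegral, ← integral_const_mul]
  simp only [mul_div_assoc]

theorem gapIntegrand_lt {T₁ T₂ e : ℝ} (h₁ : 0 < T₁) (h : T₁ < T₂) (he : e ≠ 0) :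
    tanh (e / (2 * T₂)) / (2 * e) < tanh (e / (2 * T₁)) / (2 * e) := by
  have key : ∀ x : ℝ, 0 < x → tanh (x / (2 * T₂)) / (2 * x) < tanh (x / (2 * T₁)) / (2 * x) :=
    fun x hx => by
      have : x / (2 * T₂) < x / (2 * T₁) := by gcongr
      have := strictMono_tanh this
      gcongr
  rcases lt_or_gt_of_ne he with h0 | h0
  · have := key (-e) (by linarith)
    simpa only [neg_div _ e, Real.tanh_neg, mul_neg, neg_div_neg_eq] using this
  · exact key e h0

/-- The integrand decreases strictly in `T` except at `e = 0`, and the band law has no atom there.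
-/
theorem gapIntegral_strictAntiOn (tz : ℝ) : StrictAntiOn (gapIntegral tz) (Ioi 0) := by
  intro T₁ h₁ T₂ h₂ h
  have i₁ := integrable_gapIntegrand tz h₁
  have i₂ := integrable_gapIntegrand tz h₂
  have hle : ∀ e, 0 ≤ tanh (e / (2 * T₁)) / (2 * e) - tanh (e / (2 * T₂)) / (2 * e) := fun e => by
    rcases eq_or_ne e 0 with rfl | he
    · simp
    · exact (sub_pos.2 (gapIntegrand_lt h₁ h he)).le
  rw [← sub_pos, gapIntegral, gapIntegral, ← integral_sub i₁ i₂,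
    integral_pos_iff_support_of_nonneg hle (i₁.sub i₂)]
  have hsub : ({0}ᶜ : Set ℝ) ⊆ Function.support fun e =>
      tanh (e / (2 * T₁)) / (2 * e) - tanh (e / (2 * T₂)) / (2 * e) := fun e he =>
    (sub_pos.2 (gapIntegrand_lt h₁ h he)).ne'
  refine lt_of_lt_of_le ?_ (measure_mono hsub)
  rw [prob_compl_eq_one_sub (measurableSet_singleton 0), measure_singleton, tsub_zero]
  exact one_pos

theorem continuousOn_gapIntegral (tz : ℝ) : ContinuousOn (gapIntegral tz) (Ioi 0) := by
  intro T hT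
  have hT : 0 < T := hT
  refine ContinuousAt.continuousWithinAt ?_
  have hnear : ∀ᶠ S in 𝓝 T, T / 2 < S := lt_mem_nhds (by linarith)
  refine continuousAt_of_dominated (bound := fun _ => (4 * (T / 2))⁻¹)
    (Eventually.of_forall fun S => (measurable_gapIntegrand S).aestronglyMeasurable) ?_
    (integrable_const _) (ae_of_all _ fun e => ?_)
  · filter_upwards [hnear] with S hS
    refine ae_of_all _ fun e => (norm_gapIntegrand_le (by linarith) e).trans ?_
    gcongr
  · have : ContinuousAt (fun S : ℝ => e / (2 * S)) T :=
      continuousAt_const.div (by fun_prop) (by positivity)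
    exact (continuous_tanh.continuousAt.comp this).div_const _

theorem gapIntegral_eq {tz : ℝ} (htz : 0 < tz) (T : ℝ) :
    gapIntegral tz T
      = ∫ e in (0 : ℝ)..(4 + 2 * tz), densityOfStates tz e * (tanh (e / (2 * T)) / e) := by
  rw [gapIntegral, integral_bandLaw_of_even htz fun e => by
    rw [neg_div, Real.tanh_neg, mul_neg, neg_div_neg_eq]]
  refine intervalIntegral.integral_congr fun e _ => ?_
  rw [mul_comm 2 e, ← div_div]
  ring

/-! ### Low-temperature expansion of the gap integral. -/

/-- Uniform control of the density of states near `0`. -/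
structure DensityBounds (δ B c tz : ℝ) : Prop where
  pos : 0 < tz
  lt_two : tz < 2
  radius_pos : 0 < δ
  radius_le_one : δ ≤ 1
  lower_pos : 0 < c
  lower : c ≤ densityOfStates tz 0
  upper : densityOfStates tz 0 ≤ B
  quadratic : ∀ e, |e| < δ → |densityOfStates tz e - densityOfStates tz 0| ≤ B * e ^ 2

namespace DensityBounds

variable {δ B c tz : ℝ}

theorem bound_pos (h : DensityBounds δ B c tz) : 0 < B :=
  h.lower_pos.trans_le (h.lower.trans h.upper)

theorem abs_sub_le (h : DensityBounds δ B c tz) (e : ℝ) :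
    |densityOfStates tz e - densityOfStates tz 0| ≤ densityOfStates tz e + B := by
  have h1 := densityOfStates_nonneg tz e
  have h2 := densityOfStates_nonneg tz 0
  have h3 := h.upper
  rw [abs_le]
  constructor <;> linarith

/-- For `e < δ` the quadratic bound cancels `1/e`. For `e ≥ δ` only `1/e ≤ 1/δ` is used: `N` need
not be bounded there, since its integral is at most `1`. -/
theorem abs_bZeroIntegrand_le (h : DensityBounds δ B c tz) {e : ℝ} (he : 0 < e) :
    |(densityOfStates tz e - densityOfStates tz 0) * (1 / e)|
      ≤ B + (densityOfStates tz e + B) * δ⁻¹ := by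
  have hB := h.bound_pos
  have hN := densityOfStates_nonneg tz e
  have hδ := h.radius_pos
  rw [abs_mul, abs_of_pos (one_div_pos.2 he), one_div, ← div_eq_mul_inv]
  rcases lt_or_ge e δ with h1 | h1
  · have h2 := h.quadratic e (by rwa [abs_of_pos he])
    have h3 : |densityOfStates tz e - densityOfStates tz 0| / e ≤ B := by
      rw [div_le_iff₀ he]
      refine h2.trans ?_
      have : e ≤ 1 := h1.le.trans h.radius_le_one
      rw [sq]
      gcongr
      nlinarith
    have : 0 ≤ (densityOfStates tz e + B) * δ⁻¹ := by positivity
    linarith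
  · have h3 : |densityOfStates tz e - densityOfStates tz 0| / e
        ≤ (densityOfStates tz e + B) * δ⁻¹ := by
      rw [← div_eq_mul_inv]
      exact div_le_div₀ (by positivity) (h.abs_sub_le e) hδ h1
    linarith

/-- For `e < δ` the quadratic bound leaves a factor `e` against `exp (-e/T)`, whose integral is at
most `T²`. For `e ≥ δ` the factor `1 - tanh` is itself `O(T²)`. -/
theorem abs_remainder_le (h : DensityBounds δ B c tz) {T e : ℝ} (hT : 0 < T) (he : 0 < e) :
    |(densityOfStates tz e - densityOfStates tz 0) * (1 / e) * (1 - tanh (e / (2 * T)))|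
      ≤ 2 * B * (e * exp (-e / T)) + (densityOfStates tz e + B) * (4 * T ^ 2 / δ ^ 3) := by
  have hB := h.bound_pos
  have hN := densityOfStates_nonneg tz e
  have hδ := h.radius_pos
  have ht := one_sub_tanh_nonneg (e / (2 * T))
  rw [abs_mul, abs_of_nonneg ht, abs_mul, abs_of_pos (one_div_pos.2 he), one_div,
    ← div_eq_mul_inv]
  rcases lt_or_ge e δ with h1 | h1
  · have h2 := h.quadratic e (by rwa [abs_of_pos he])
    have h3 : |densityOfStates tz e - densityOfStates tz 0| / e ≤ B * e := by
      rw [div_le_iff₀ he]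
      linarith
    have h4 := one_sub_tanh_le_exp (e / (2 * T))
    have h5 : -(2 * (e / (2 * T))) = -e / T := by field_simp
    rw [h5] at h4
    have h6 : 0 ≤ (densityOfStates tz e + B) * (4 * T ^ 2 / δ ^ 3) := by positivity
    have h7 := mul_le_mul h3 h4 ht (by positivity)
    linarith
  · have h3 : |densityOfStates tz e - densityOfStates tz 0| / e
        ≤ (densityOfStates tz e + B) / δ :=
      div_le_div₀ (by positivity) (h.abs_sub_le e) hδ h1
    have h4 := one_sub_tanh_le_inv_sq (x := e / (2 * T)) (by positivity)
    have h5 : 1 / (e / (2 * T)) ^ 2 ≤ 4 * T ^ 2 / δ ^ 2 := by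
      have : 1 / (e / (2 * T)) ^ 2 = 4 * T ^ 2 / e ^ 2 := by
        field_simp
        norm_num
      rw [this]
      gcongr
    have h7 := mul_le_mul h3 (h4.trans h5) ht (by positivity)
    have h8 : (densityOfStates tz e + B) / δ * (4 * T ^ 2 / δ ^ 2)
        = (densityOfStates tz e + B) * (4 * T ^ 2 / δ ^ 3) := by
      field_simp
    have h9 := Real.exp_pos (-e / T)
    have h10 : 0 ≤ 2 * B * (e * exp (-e / T)) := by positivity
    linarith

theorem intervalIntegrable_densityOfStates (tz a b : ℝ) :
    IntervalIntegrable (densityOfStates tz) volume a b :=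
  (integrable_densityOfStates tz).intervalIntegrable

theorem intervalIntegrable_bZeroIntegrand (h : DensityBounds δ B c tz) :
    IntervalIntegrable (fun e => (densityOfStates tz e - densityOfStates tz 0) * (1 / e))
      volume 0 (4 + 2 * tz) := by
  have hpos := h.pos
  have hi := (intervalIntegrable_const (μ := volume) (a := 0) (b := 4 + 2 * tz) (c := B)).add
    (((intervalIntegrable_densityOfStates tz 0 (4 + 2 * tz)).add
      (intervalIntegrable_const (c := B))).mul_const δ⁻¹)
  refine hi.mono_fun' ?_ ?_
  · exact (((measurable_densityOfStates tz).sub_const _).mul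
      (measurable_const.div measurable_id)).aestronglyMeasurable
  · rw [uIoc_of_le (by linarith)]
    exact (ae_restrict_mem measurableSet_Ioc).mono fun e he => h.abs_bZeroIntegrand_le he.1

theorem integral_densityOfStates_add_le (h : DensityBounds δ B c tz) :
    ∫ e in (0 : ℝ)..(4 + 2 * tz), (densityOfStates tz e + B) ≤ 1 + 8 * B := by
  have hpos := h.pos
  have hlt := h.lt_two
  have hB := h.bound_pos
  rw [intervalIntegral.integral_add (intervalIntegrable_densityOfStates _ _ _)
    intervalIntegrable_const, intervalIntegral.integral_const, smul_eq_mul]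
  have h1 : ∫ e in (0 : ℝ)..(4 + 2 * tz), densityOfStates tz e ≤ 1 := by
    rw [← integral_densityOfStates tz, intervalIntegral.integral_of_le (by linarith)]
    exact setIntegral_le_integral (integrable_densityOfStates tz)
      (ae_of_all _ (densityOfStates_nonneg tz))
  nlinarith

theorem abs_bZero_le (h : DensityBounds δ B c tz) :
    |bZero tz| ≤ 8 * B + (1 + 8 * B) * δ⁻¹ := by
  have hpos := h.pos
  have hlt := h.lt_two
  have hB := h.bound_pos
  have hδ := h.radius_pos
  have i1 := (intervalIntegrable_densityOfStates tz 0 (4 + 2 * tz)).add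
    (intervalIntegrable_const (μ := volume) (a := 0) (b := 4 + 2 * tz) (c := B))
  have i0 := intervalIntegrable_const (μ := volume) (a := 0) (b := 4 + 2 * tz) (c := B)
  have h1 := intervalIntegral.norm_integral_le_of_norm_le (by linarith : 0 ≤ 4 + 2 * tz)
    (ae_of_all _ fun e he => (Real.norm_eq_abs _).trans_le (h.abs_bZeroIntegrand_le he.1)) (i0.add (i1.mul_const δ⁻¹))
  rw [intervalIntegral.integral_add i0 (i1.mul_const δ⁻¹), intervalIntegral.integral_mul_const,
    intervalIntegral.integral_const, smul_eq_mul] at h1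
  have h2 := mul_le_mul_of_nonneg_right h.integral_densityOfStates_add_le (inv_nonneg.2 hδ.le)
  have h3 : (4 + 2 * tz - 0) * B ≤ 8 * B := by nlinarith
  exact h1.trans (add_le_add h3 h2)

end DensityBounds

theorem integral_mul_exp_neg_div_le {T a : ℝ} (hT : 0 < T) (ha : 0 ≤ a) :
    ∫ e in (0 : ℝ)..a, e * exp (-e / T) ≤ T ^ 2 := by
  have hd : ∀ e ∈ uIcc 0 a, HasDerivAt (fun e => -(T * e + T ^ 2) * exp (-e / T))
      (e * exp (-e / T)) e := fun e _ => by
    have h1 : HasDerivAt (fun e : ℝ => -(T * e + T ^ 2)) (-T) e := by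
      exact ((((hasDerivAt_id e).const_mul T).add_const (T ^ 2)).neg).congr_deriv (by simp)
    have h2 : HasDerivAt (fun e : ℝ => exp (-e / T)) (exp (-e / T) * (-1 / T)) e :=
      ((hasDerivAt_neg e).div_const T).exp
    refine (h1.mul h2).congr_deriv ?_
    field_simp
    ring
  rw [intervalIntegral.integral_eq_sub_of_hasDerivAt hd
    (Continuous.intervalIntegrable (by fun_prop) _ _)]
  have : 0 ≤ (T * a + T ^ 2) * exp (-a / T) := by positivity
  simp
  linarith

/-- The low temperature expansion of the gap integral. -/
theorem DensityBounds.abs_gapIntegral_sub_le {δ B c tz : ℝ} (h : DensityBounds δ B c tz) {T : ℝ}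
    (hT : 0 < T) :
    |gapIntegral tz T - (densityOfStates tz 0 * (log ((4 + 2 * tz) / (2 * T))
        + (log (4 / π) + Real.eulerMascheroniConstant)) + bZero tz)|
      ≤ (3 * B + (1 + 8 * B) * (4 / δ ^ 3)) * T ^ 2 := by
  have hpos := h.pos
  have hlt := h.lt_two
  have hB := h.bound_pos
  have hδ := h.radius_pos
  have ha : 0 < 4 + 2 * tz := by linarith
  set a := 4 + 2 * tz with hadef
  set N₀ := densityOfStates tz 0 with hN₀
  have hN₀0 : 0 < N₀ := h.lower_pos.trans_le h.lower
  have i2 := h.intervalIntegrable_bZeroIntegrand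
  have hcomp : ∀ e : ℝ, tanh (e / (2 * T)) / e
      = (2 * T)⁻¹ * (tanh (e / (2 * T)) / (e / (2 * T))) := fun e => by
    field_simp
  have i1 : IntervalIntegrable (fun e => N₀ * (tanh (e / (2 * T)) / e)) volume 0 a := by
    refine IntervalIntegrable.const_mul ?_ _
    simp only [hcomp]
    refine IntervalIntegrable.const_mul ?_ _
    refine (intervalIntegrable_const (c := (1 : ℝ))).mono_fun'
      (measurable_tanh_div.comp (measurable_id.div_const (2 * T))).aestronglyMeasurable
      (ae_of_all _ fun e => ?_)
    exact (Real.norm_of_nonneg (tanh_div_nonneg _)).trans_le (tanh_div_le_one _)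
  have j1 : ∫ e in (0 : ℝ)..a, N₀ * (tanh (e / (2 * T)) / e)
      = N₀ * ∫ x in (0 : ℝ)..a / (2 * T), tanh x / x := by
    rw [intervalIntegral.integral_const_mul]
    simp only [hcomp]
    rw [intervalIntegral.integral_const_mul]
    have := intervalIntegral.inv_mul_integral_comp_div (a := 0) (b := a)
      (f := fun x => tanh x / x) (2 * T)
    rw [zero_div] at this
    rw [← this]
  have ib : IntervalIntegrable (fun e => 2 * B * (e * exp (-e / T))
      + (densityOfStates tz e + B) * (4 * T ^ 2 / δ ^ 3)) volume 0 a :=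
    (Continuous.intervalIntegrable (by fun_prop) _ _).add
      (((DensityBounds.intervalIntegrable_densityOfStates tz 0 a).add
        intervalIntegrable_const).mul_const _)
  have i3 : IntervalIntegrable (fun e => (densityOfStates tz e - N₀) * (1 / e)
      * (1 - tanh (e / (2 * T)))) volume 0 a := by
    refine ib.mono_fun' ?_ ?_
    · exact ((((measurable_densityOfStates tz).sub_const _).mul
        (measurable_const.div measurable_id)).mul (measurable_const.sub
          (continuous_tanh.measurable.comp (measurable_id.div_const _)))).aestronglyMeasurable
    · rw [uIoc_of_le ha.le]
      exact (ae_restrict_mem measurableSet_Ioc).mono fun e he => h.abs_remainder_le hT he.1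
  -- Uses `N tanh = N₀ tanh + (N - N₀) - (N - N₀)(1 - tanh)`.
  have hsplit : gapIntegral tz T = N₀ * (∫ x in (0 : ℝ)..a / (2 * T), tanh x / x) + bZero tz
      - ∫ e in (0 : ℝ)..a, (densityOfStates tz e - N₀) * (1 / e) * (1 - tanh (e / (2 * T))) := by
    rw [gapIntegral_eq hpos, bZero, ← j1, ← intervalIntegral.integral_add i1 i2,
      ← intervalIntegral.integral_sub (i1.add i2) i3]
    refine intervalIntegral.integral_congr fun e _ => ?_
    ring
  have hrem : |∫ e in (0 : ℝ)..a, (densityOfStates tz e - N₀) * (1 / e)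
      * (1 - tanh (e / (2 * T)))| ≤ 2 * B * T ^ 2 + (1 + 8 * B) * (4 * T ^ 2 / δ ^ 3) := by
    have h1 := intervalIntegral.norm_integral_le_of_norm_le ha.le
      (ae_of_all _ fun e he => (Real.norm_eq_abs _).trans_le (h.abs_remainder_le hT he.1)) ib
    rw [intervalIntegral.integral_add (Continuous.intervalIntegrable (by fun_prop) _ _)
      (((DensityBounds.intervalIntegrable_densityOfStates tz 0 a).add
        intervalIntegrable_const).mul_const _), intervalIntegral.integral_mul_const,
      intervalIntegral.integral_const_mul] at h1
    refine h1.trans (add_le_add ?_ ?_)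
    · have := integral_mul_exp_neg_div_le hT ha.le
      gcongr
    · have := h.integral_densityOfStates_add_le
      gcongr
  have hJ := abs_integral_tanh_div_sub_le (X := a / (2 * T)) (by positivity)
  -- Since `a ≥ 4`, `4T²/a² ≤ T²`.
  have hJ2 : 1 / (a / (2 * T)) ^ 2 ≤ T ^ 2 := by
    have h4 : 4 ≤ a := by linarith
    rw [div_pow, one_div_div, div_le_iff₀ (by positivity)]
    have : 16 ≤ a ^ 2 := by nlinarith
    nlinarith [sq_nonneg T]
  set J := ∫ x in (0 : ℝ)..a / (2 * T), tanh x / x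
  set R := ∫ e in (0 : ℝ)..a, (densityOfStates tz e - N₀) * (1 / e) * (1 - tanh (e / (2 * T)))
  have e1 : gapIntegral tz T - (N₀ * (log (a / (2 * T))
      + (log (4 / π) + Real.eulerMascheroniConstant)) + bZero tz)
      = N₀ * (J - log (a / (2 * T)) - (log (4 / π) + Real.eulerMascheroniConstant)) - R := by
    rw [hsplit]
    ring
  rw [e1]
  refine (abs_sub _ _).trans ?_
  rw [abs_mul, abs_of_pos hN₀0]
  have h5 := mul_le_mul h.upper (hJ.trans hJ2) (abs_nonneg _) hB.le
  calc _ ≤ B * T ^ 2 + (2 * B * T ^ 2 + (1 + 8 * B) * (4 * T ^ 2 / δ ^ 3)) := add_le_add h5 hrem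
    _ = _ := by ring

theorem exists_densityBounds {a b : ℝ} (ha : 0 < a) (hb : b < 2) :
    ∃ δ B c : ℝ, ∀ tz ∈ Icc a b, DensityBounds δ B c tz := by
  obtain ⟨δ, B, c, h1, h2, h3, _, h5⟩ := exists_densityOfStates_bounds ha hb
  exact ⟨δ, B, c, fun tz htz => ⟨ha.trans_le htz.1, htz.2.trans_lt hb, h1, h2, h3,
    (h5 tz htz).1, (h5 tz htz).2.1, (h5 tz htz).2.2⟩⟩

/-! ### Existence and asymptotics of the Néel temperature. -/

/-- The Néel temperature to leading order. -/
def leadingNeelTemperature (U tz : ℝ) : ℝ :=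
  (8 + 4 * tz) / (π * exp (-Real.eulerMascheroniConstant)) *
    exp (-(1 / densityOfStates tz 0) * (1 / U - bZero tz))

namespace DensityBounds

variable {δ B c tz : ℝ}

theorem densityOfStates_zero_pos (h : DensityBounds δ B c tz) : 0 < densityOfStates tz 0 :=
  h.lower_pos.trans_le h.lower

theorem continuousAt_densityOfStates (h : DensityBounds δ B c tz) :
    ContinuousAt (densityOfStates tz) 0 := by
  rw [ContinuousAt, tendsto_iff_norm_sub_tendsto_zero]
  have hz : Tendsto (fun e : ℝ => B * e ^ 2) (𝓝 0) (𝓝 0) := by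
    have : Continuous fun e : ℝ => B * e ^ 2 := by fun_prop
    simpa using this.tendsto 0
  refine squeeze_zero' (Eventually.of_forall fun _ => norm_nonneg _) ?_ hz
  have := continuous_abs.continuousAt.eventually (gt_mem_nhds (show |(0 : ℝ)| < δ by
    rw [abs_zero]; exact h.radius_pos))
  filter_upwards [this] with e he using h.quadratic e he

theorem tendsto_gapIntegral (h : DensityBounds δ B c tz) :
    Tendsto (gapIntegral tz) (𝓝[>] 0) atTop := by
  have hpos := h.pos
  have hN := h.densityOfStates_zero_pos
  set κ := log (4 / π) + Real.eulerMascheroniConstant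
  set C := 3 * B + (1 + 8 * B) * (4 / δ ^ 3)
  have h1 : Tendsto (fun T : ℝ => log ((4 + 2 * tz) / (2 * T))) (𝓝[>] 0) atTop := by
    refine Real.tendsto_log_atTop.comp ?_
    have h2 : Tendsto (fun T : ℝ => (4 + 2 * tz) / 2 * T⁻¹) (𝓝[>] 0) atTop :=
      tendsto_inv_nhdsGT_zero.const_mul_atTop (by positivity)
    refine h2.congr fun T => ?_
    rw [← div_div, div_eq_mul_inv _ T]
  have h2 : Tendsto (fun T : ℝ => densityOfStates tz 0 * (log ((4 + 2 * tz) / (2 * T)) + κ)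
      + (bZero tz - C)) (𝓝[>] 0) atTop :=
    tendsto_atTop_add_const_right _ _
      ((tendsto_atTop_add_const_right _ _ h1).const_mul_atTop hN)
  refine tendsto_atTop_mono' _ ?_ h2
  filter_upwards [Ioo_mem_nhdsGT (one_pos : (0 : ℝ) < 1)] with T hT
  have h3 := (abs_le.1 (h.abs_gapIntegral_sub_le hT.1)).1
  have hB := h.bound_pos
  have hδ := h.radius_pos
  have hC : 0 ≤ C := by positivity
  have h4 : T ^ 2 ≤ 1 := pow_le_one₀ hT.1.le hT.2.le
  nlinarith

/-- Intermediate value theorem: the gap integral tends to infinity as `T ↓ 0` and is at most `1/U`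
at `T = U/4`. -/
theorem exists_isNeelTemperature (h : DensityBounds δ B c tz) {U : ℝ} (hU : 0 < U) :
    ∃ T, IsNeelTemperature U tz T := by
  obtain ⟨S, hS1, hS2⟩ := ((h.tendsto_gapIntegral.eventually_ge_atTop U⁻¹).and
    (Ioo_mem_nhdsGT (show (0 : ℝ) < U / 4 by positivity))).exists
  have hle : gapIntegral tz (U / 4) ≤ U⁻¹ := by
    refine (gapIntegral_le tz (by positivity)).trans_eq ?_
    congr 1
    ring
  obtain ⟨T, hT, hTe⟩ := intermediate_value_Icc' hS2.2.le
    ((continuousOn_gapIntegral tz).mono fun x hx => mem_Ioi.2 (hS2.1.trans_le hx.1)) ⟨hle, hS1⟩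
  refine ⟨T, isNeelTemperature_iff.2 ⟨hS2.1.trans_le hT.1, ?_⟩⟩
  rw [hTe, mul_inv_cancel₀ hU.ne']

theorem isNeelTemperature_neelTemperature (h : DensityBounds δ B c tz) {U : ℝ} (hU : 0 < U) :
    IsNeelTemperature U tz (neelTemperature U tz) :=
  Classical.epsilon_spec (h.exists_isNeelTemperature hU)

theorem leadingNeelTemperature_pos (h : DensityBounds δ B c tz) (U : ℝ) :
    0 < leadingNeelTemperature U tz := by
  have := h.pos
  unfold leadingNeelTemperature
  positivity

/-- The leading temperature solves the expansion exactly without its error term. So `r`, the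
difference of logarithms, is that error divided by `N(0) ≥ c`. -/
theorem exists_neelTemperature_eq (h : DensityBounds δ B c tz) {U : ℝ} (hU : 0 < U) :
    ∃ r, neelTemperature U tz = leadingNeelTemperature U tz * exp r ∧
      |r| ≤ (3 * B + (1 + 8 * B) * (4 / δ ^ 3)) / c * neelTemperature U tz ^ 2 := by
  have hpos := h.pos
  have hN := h.densityOfStates_zero_pos
  have hB := h.bound_pos
  have hδ := h.radius_pos
  obtain ⟨hT, hTe⟩ := isNeelTemperature_iff.1 (h.isNeelTemperature_neelTemperature hU)
  have hlead := h.leadingNeelTemperature_pos U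
  set T := neelTemperature U tz
  set κ := log (4 / π) + Real.eulerMascheroniConstant with hκ
  set N₀ := densityOfStates tz 0 with hN₀
  have hgap : gapIntegral tz T = 1 / U := by
    rw [eq_div_iff hU.ne', mul_comm, ← hTe]
  have hb := h.abs_gapIntegral_sub_le hT
  rw [hgap, ← hκ, ← hN₀] at hb
  have hlog : log (leadingNeelTemperature U tz)
      = log ((4 + 2 * tz) / (2 * T)) + log T + κ - (1 / N₀) * (1 / U - bZero tz) := by
    have e1 : (8 + 4 * tz) / (π * exp (-Real.eulerMascheroniConstant))
        = (4 + 2 * tz) / (2 * T) * T * (4 / π) * exp Real.eulerMascheroniConstant := by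
      rw [Real.exp_neg]
      field_simp
      ring
    rw [leadingNeelTemperature, e1, Real.log_mul (by positivity) (by positivity),
      Real.log_mul (by positivity) (by positivity), Real.log_mul (by positivity) (by positivity),
      Real.log_mul (by positivity) (by positivity), Real.log_exp, Real.log_exp, hκ]
    ring
  refine ⟨log T - log (leadingNeelTemperature U tz), ?_, ?_⟩
  · rw [Real.exp_sub, Real.exp_log hT, Real.exp_log hlead, mul_div_cancel₀ _ hlead.ne']
  · have e2 : log T - log (leadingNeelTemperature U tz)
        = (1 / U - (N₀ * (log ((4 + 2 * tz) / (2 * T)) + κ) + bZero tz)) / N₀ := by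
      rw [hlog]
      field_simp
      ring
    rw [e2, abs_div, abs_of_pos hN, div_mul_eq_mul_div]
    exact div_le_div₀ (by positivity) hb h.lower_pos h.lower

theorem neelTemperature_le (h : DensityBounds δ B c tz) {U : ℝ} (hU : 0 < U) :
    neelTemperature U tz ≤ U / 4 := by
  obtain ⟨hT, hTe⟩ := isNeelTemperature_iff.1 (h.isNeelTemperature_neelTemperature hU)
  have h1 := mul_le_mul_of_nonneg_left (gapIntegral_le tz hT) hU.le
  rw [← hTe, ← div_eq_mul_inv, le_div_iff₀ (by positivity)] at h1
  linarith

theorem leadingNeelTemperature_sq_le (h : DensityBounds δ B c tz) (U : ℝ) :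
    leadingNeelTemperature U tz ^ 2 ≤ (16 / (π * exp (-Real.eulerMascheroniConstant))) ^ 2
      * exp (2 * ((8 * B + (1 + 8 * B) * δ⁻¹) / c))
      * exp (-(2 / (densityOfStates tz 0 * U))) := by
  have hpos := h.pos
  have hlt := h.lt_two
  have hN := h.densityOfStates_zero_pos
  have hB := h.bound_pos
  have hδ := h.radius_pos
  have h1 : bZero tz / densityOfStates tz 0 ≤ (8 * B + (1 + 8 * B) * δ⁻¹) / c := by
    refine (div_le_div_of_nonneg_right ((le_abs_self _).trans h.abs_bZero_le) hN.le).trans ?_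
    exact div_le_div_of_nonneg_left (by positivity) h.lower_pos h.lower
  rw [leadingNeelTemperature, mul_pow, mul_assoc _ (exp _) (exp _), ← Real.exp_add,
    ← Real.exp_nat_mul]
  have h2 : (8 + 4 * tz) / (π * exp (-Real.eulerMascheroniConstant))
      ≤ 16 / (π * exp (-Real.eulerMascheroniConstant)) := by
    gcongr
    linarith
  have h3 : ((2 : ℕ) : ℝ) * (-(1 / densityOfStates tz 0) * (1 / U - bZero tz))
      = 2 * (bZero tz / densityOfStates tz 0) + -(2 / (densityOfStates tz 0 * U)) := by
    push_cast
    rw [← div_div]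
    ring
  rw [h3]
  gcongr

end DensityBounds

theorem exists_neelTemperature_expansion {δ B c : ℝ} {K : Set ℝ}
    (hK : ∀ tz ∈ K, DensityBounds δ B c tz) :
    ∃ C U₀ : ℝ, 0 < U₀ ∧ ∀ U ∈ Ioo (0 : ℝ) U₀, ∀ tz ∈ K,
      |neelTemperature U tz / leadingNeelTemperature U tz - 1|
        ≤ C * exp (-(2 / (densityOfStates tz 0 * U))) := by
  rcases K.eq_empty_or_nonempty with rfl | ⟨t₀, ht₀⟩
  · exact ⟨0, 1, one_pos, by simp⟩
  have hB := (hK t₀ ht₀).bound_pos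
  have hδ := (hK t₀ ht₀).radius_pos
  have hc := (hK t₀ ht₀).lower_pos
  obtain ⟨D, hD⟩ : ∃ D, D = (3 * B + (1 + 8 * B) * (4 / δ ^ 3)) / c := ⟨_, rfl⟩
  obtain ⟨A, hA⟩ : ∃ A, A = (16 / (π * exp (-Real.eulerMascheroniConstant))) ^ 2
      * exp (2 * ((8 * B + (1 + 8 * B) * δ⁻¹) / c)) := ⟨_, rfl⟩
  have hD0 : 0 < D := by rw [hD]; positivity
  -- For `U < 1/(1 + D)`, both `U` and `D U` are below `1`, so `T ≤ U/4` gives `T² ≤ U` and `|r| ≤ D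
  -- T² ≤ 1`. Then `exp r ≤ 3` yields the `9` in the bound for `T²`, `A` bounds the squared
  -- prefactor, and `2` comes from `|exp r - 1| ≤ 2|r|`.
  refine ⟨2 * D * (9 * A), (1 + D)⁻¹, by positivity, fun U hU tz htz => ?_⟩
  have h := hK tz htz
  obtain ⟨hT, -⟩ := h.isNeelTemperature_neelTemperature hU.1
  have hle := h.neelTemperature_le hU.1
  have hlead := h.leadingNeelTemperature_pos U
  have hsq := h.leadingNeelTemperature_sq_le U
  obtain ⟨r, hr1, hr2⟩ := h.exists_neelTemperature_eq hU.1
  rw [← hD] at hr2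
  rw [← hA] at hsq
  have hU1 : U * (1 + D) < 1 := by
    have := mul_lt_mul_of_pos_right hU.2 (show 0 < 1 + D by positivity)
    rwa [inv_mul_cancel₀ (by positivity)] at this
  have hU2 : U < 1 := by nlinarith [hU.1]
  have hT2 : neelTemperature U tz ^ 2 ≤ U := by nlinarith [hU.1]
  have hr3 : |r| ≤ 1 := by
    refine hr2.trans ?_
    nlinarith [hU.1]
  have he : exp r ≤ 3 :=
    (Real.exp_le_exp.2 ((le_abs_self r).trans hr3)).trans (by linarith [Real.exp_one_lt_d9])
  rw [hr1, mul_div_cancel_left₀ _ hlead.ne']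
  have h9 : neelTemperature U tz ^ 2 ≤ 9 * leadingNeelTemperature U tz ^ 2 := by
    have h3 : neelTemperature U tz ≤ 3 * leadingNeelTemperature U tz := by
      rw [hr1]
      nlinarith
    nlinarith
  calc |exp r - 1| ≤ 2 * |r| := Real.abs_exp_sub_one_le hr3
    _ ≤ 2 * (D * (9 * (A * exp (-(2 / (densityOfStates tz 0 * U)))))) := by
      have := mul_le_mul_of_nonneg_left (h9.trans (mul_le_mul_of_nonneg_left hsq (by norm_num)))
        hD0.le
      linarith
    _ = _ := by ring

theorem exists_Icc_of_isCompact {K : Set ℝ} (hK : IsCompact K) (hsub : K ⊆ Ioo (0 : ℝ) 2) :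
    ∃ a b : ℝ, 0 < a ∧ b < 2 ∧ K ⊆ Icc a b := by
  rcases K.eq_empty_or_nonempty with rfl | hne
  · exact ⟨1, 1, one_pos, one_lt_two, empty_subset _⟩
  obtain ⟨a, ha, ha'⟩ := hK.exists_isLeast hne
  obtain ⟨b, hb, hb'⟩ := hK.exists_isGreatest hne
  exact ⟨a, b, (hsub ha).1, (hsub hb).2, fun x hx => ⟨ha' hx, hb' hx⟩⟩

end Hubbard

end

theorem theorem2p3 :
    -- For `0 < t_z < 2` all the quantities in the asymptotic formula are well defined:
    -- `N_{t_z}` is the density of the distribution of `ε(k)`, it is continuous and positive at `0`,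
    -- the integral `b₀(t_z)` converges, and there is a unique Néel temperature.
    (∀ tz ∈ Set.Ioo (0 : ℝ) 2,
      Hubbard.momentumMeasure.map (Hubbard.band tz) =
          volume.withDensity (fun e => ENNReal.ofReal (Hubbard.densityOfStates tz e)) ∧
        ContinuousAt (Hubbard.densityOfStates tz) 0 ∧
        0 < Hubbard.densityOfStates tz 0 ∧
        IntervalIntegrable
          (fun e => (Hubbard.densityOfStates tz e - Hubbard.densityOfStates tz 0) * (1 / e))
          volume 0 (4 + 2 * tz) ∧
        ∀ U : ℝ, 0 < U →
          Hubbard.IsNeelTemperature U tz (Hubbard.neelTemperature U tz) ∧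
            ∀ T : ℝ, Hubbard.IsNeelTemperature U tz T → T = Hubbard.neelTemperature U tz) ∧
    -- The asymptotic formula as `U ↓ 0`, uniformly for `t_z` in compact subsets of `(0, 2)`.
    (∀ K : Set ℝ, IsCompact K → K ⊆ Set.Ioo (0 : ℝ) 2 →
      ∃ C U₀ : ℝ, 0 < U₀ ∧ ∃ E : ℝ → ℝ → ℝ,
        ∀ U ∈ Set.Ioo (0 : ℝ) U₀, ∀ tz ∈ K,
          Hubbard.neelTemperature U tz =
              (8 + 4 * tz) / (Real.pi * Real.exp (-Real.eulerMascheroniConstant)) *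
                Real.exp (-(1 / Hubbard.densityOfStates tz 0) * (1 / U - Hubbard.bZero tz)) *
                (1 + E U tz) ∧
            |E U tz| ≤ C * Real.exp (-(2 / (Hubbard.densityOfStates tz 0 * U)))) := by
  refine ⟨fun tz htz => ?_, fun K hK hsub => ?_⟩
  · obtain ⟨δ, B, c, h⟩ := Hubbard.exists_densityBounds htz.1 htz.2
    have h := h tz ⟨le_rfl, le_rfl⟩
    refine ⟨Hubbard.bandLaw_eq_withDensity tz, h.continuousAt_densityOfStates,
      h.densityOfStates_zero_pos, h.intervalIntegrable_bZeroIntegrand, fun U hU => ?_⟩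
    have hT := h.isNeelTemperature_neelTemperature hU
    refine ⟨hT, fun T hT' => ?_⟩
    obtain ⟨h1, e1⟩ := Hubbard.isNeelTemperature_iff.1 hT
    obtain ⟨h2, e2⟩ := Hubbard.isNeelTemperature_iff.1 hT'
    exact (Hubbard.gapIntegral_strictAntiOn tz).injOn h2 h1
      (mul_left_cancel₀ hU.ne' (e2.symm.trans e1))
  · obtain ⟨a, b, ha, hb, hab⟩ := Hubbard.exists_Icc_of_isCompact hK hsub
    obtain ⟨δ, B, c, h⟩ := Hubbard.exists_densityBounds ha hb
    have h : ∀ tz ∈ K, Hubbard.DensityBounds δ B c tz := fun tz htz => h tz (hab htz)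
    obtain ⟨C, U₀, hU₀, hE⟩ := Hubbard.exists_neelTemperature_expansion h
    refine ⟨C, U₀, hU₀,
      fun U tz => Hubbard.neelTemperature U tz / Hubbard.leadingNeelTemperature U tz - 1,
      fun U hU tz htz => ⟨?_, hE U hU tz htz⟩⟩
    rw [← Hubbard.leadingNeelTemperature, add_sub_cancel,
      mul_div_cancel₀ _ ((h tz htz).leadingNeelTemperature_pos U).ne']
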